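/- **Model (shared D2D-enabled cellular network, one typical resource block).** Base stations (BSs) form a homogeneous Poisson point process $\Phi_B$ of density $\lambda_B>0$ in $\mathbb{R}^2$. There are $M\ge 0$ types of potential D2D transmitters, those of type $i$ forming a homogeneous Poisson point process $\Phi_{D_i}$ of density $\lambda_{D_i}>0$. A D2D transmitter of type $i$ is active in the time slot with probability $p_{t_i}\in[0,1]$ and accesses the subband with probability $p_{f_i}\in[0,1]$; it interferes if both happen. Every BS other than the serving one transmits on the resource block with probability $$\rho^{(S)}=\min\left\{\frac{b_C\lambda_U+\sum_{i=1}^M b_{D_i}(1-p_{t_i})\lambda_{D_i}}{\lambda_B B},\,1\right\},$$ where $\lambda_U>0$ is the density of cellular users, $b_C,b_{D_i}\ge 0$ are the service demands and $B\ge1$ is the number of subbands. All links have Rayleigh fading (i.i.d. exponential powers $h$ of mean $1$). The point processes, the fading variables, the time and frequency choices of the D2D transmitters and the transmission choices of the BSs are mutually independent. Transmit powers are $P_B>0$ (BSs) and $P_D>0$ (D2D), the noise power is $\sigma^2\ge 0$, and a signal sent from $x$ is attenuated by $|x|^{-\alpha}$ with $\alpha>2$. The typical cellular user is at the origin and is served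 by its nearest BS $B_0$, at distance $R=|B_0|$. Its SINR is $$\mathrm{SINR}=\frac{P_B h_0 R^{-\alpha}}{I_{D}+I_{B}+\sigma^2},\qquad I_D=\sum_{X_i} P_D h_i|X_i|^{-\alpha},\qquad I_B=\sum_{B_i\ne B_0}P_B h_i|B_i|^{-\alpha},$$ where the sums run over the interfering D2D transmitters and over the transmitting BSs other than $B_0$, respectively. (The SINR is $+\infty$ if its denominator is $0$.) **Theorem.** Let $\beta>0$ and, for $r>0$, put $s=s(r)=\beta r^\alpha/P_B$. Then $R$ has density $2\pi\lambda_B r e^{-\pi\lambda_B r^2}$ on $(0,\infty)$, and $$\mathbb{P}(\mathrm{SINR}>\beta)=\int_0^\infty e^{-s\sigma^2}\,\mathcal{L}_{I_D}(s)\,\mathcal{L}_{I_B\mid r}(s)\,2\pi\lambda_B r\,e^{-\pi\lambda_B r^2}\,dr,$$ with an integrable integrand. Here $\mathcal{L}_{I_D}$ is the Laplace transform of $I_D$ and $\mathcal{L}_{I_B\mid r}$ is the Laplace transform of the conditional law of $I_B$ given $R=r$, and they are given by $$\mathcal{L}_{I_D}(u)=\exp\left(-\tilde\lambda_D\,\frac{2\pi^2/\alpha}{\sin(2\pi/\alpha)}\,(uP_D)^{2/\alpha}\right)\quad(u\ge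 0),\qquad \tilde\lambda_D=\sum_{i=1}^M p_{t_i}p_{f_i}\lambda_{D_i},$$ $$\mathcal{L}_{I_B\mid r}(s(r))=\exp\left(-2\pi\rho^{(S)}\lambda_B r^2 H_1(\beta,\alpha)\right)\quad\text{for almost every } r>0,\qquad H_1(\beta,\alpha)=\int_1^\infty\frac{x}{1+\beta^{-1}x^\alpha}\,dx.$$ -/

import Mathlib

open MeasureTheory ProbabilityTheory Set
open scoped NNReal ENNReal

noncomputable section

namespace D2D

/-- The Euclidean plane; the typical cellular user sits at its origin. -/
abbrev Plane : Type := EuclideanSpace ℝ (Fin 2)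

/-! ## Poisson point processes -/

/-- Number of indices `n` with `x n ∈ A`, i.e. the mass that the counting measure
`∑ₙ δ_{x n}` gives to `A`. -/
def pointCount (x : ℕ → Plane) (A : Set Plane) : ℝ≥0∞ :=
  ∑' n, A.indicator (fun _ => (1 : ℝ≥0∞)) (x n)

/-- `X₀, X₁, …` is a measurable enumeration of the points of a homogeneous Poisson point process
of density `lam` on the plane: the number of points in a Borel set `A` of finite area is Poisson
distributed with mean `lam · area(A)`, and the numbers of points in finitely many pairwise
disjoint such sets are independent. (For `lam > 0` such a process has infinitely many points
almost surely, so its points can be indexed by `ℕ`.) -/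
structure IsHomogeneousPPP {Ω : Type*} [MeasurableSpace Ω] (μ : Measure Ω) (lam : ℝ)
    (X : ℕ → Ω → Plane) : Prop where
  measurable : ∀ n, Measurable (X n)
  count_law : ∀ A : Set Plane, MeasurableSet A → volume A ≠ ∞ →
    HasLaw (fun ω => pointCount (fun n => X n ω) A)
      ((poissonMeasure (lam.toNNReal * (volume A).toNNReal)).map
        (fun k : ℕ => (k : ℝ≥0∞))) μ
  count_indep : ∀ (m : ℕ) (A : Fin m → Set Plane), (∀ i, MeasurableSet (A i)) →
    (∀ i, volume (A i) ≠ ∞) → Pairwise (fun i j => Disjoint (A i) (A j)) →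
    iIndepFun (fun (i : Fin m) ω => pointCount (fun n => X n ω) (A i)) μ

/-! ## Parameters -/

/-- Parameters of a D2D-enabled cellular network with `M` types of potential D2D links. -/
structure Params (M : ℕ) where
  /-- density of the base stations (BSs) -/
  lamB : ℝ
  /-- density of the cellular users -/
  lamU : ℝ
  /-- density of the potential D2D transmitters of each type -/
  lamD : Fin M → ℝ
  /-- time hopping probability of each type -/
  pt : Fin M → ℝ
  /-- frequency hopping probability of each type -/
  pf : Fin M → ℝ
  /-- total number of subbands -/
  subbands : ℕ
  /-- service demand of a cellular user, in subbands -/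
  bC : ℝ
  /-- service demand of a D2D link of each type, in subbands -/
  bD : Fin M → ℝ
  /-- transmit power of the BSs -/
  PB : ℝ
  /-- transmit power of the D2D transmitters -/
  PD : ℝ
  /-- noise power `σ²` -/
  noise : ℝ
  /-- path loss exponent -/
  α : ℝ
  lamB_pos : 0 < lamB
  lamU_pos : 0 < lamU
  lamD_pos : ∀ i, 0 < lamD i
  pt_mem : ∀ i, pt i ∈ Icc (0 : ℝ) 1
  pf_mem : ∀ i, pf i ∈ Icc (0 : ℝ) 1
  subbands_pos : 0 < subbands
  bC_nonneg : 0 ≤ bC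
  bD_nonneg : ∀ i, 0 ≤ bD i
  PB_pos : 0 < PB
  PD_pos : 0 < PD
  noise_nonneg : 0 ≤ noise
  two_lt_α : 2 < α

/-- Density of the interfering D2D transmitters, `∑ᵢ p_{tᵢ} p_{fᵢ} λ_{Dᵢ}`. -/
def Params.lamDTilde {M : ℕ} (P : Params M) : ℝ :=
  ∑ i, P.pt i * P.pf i * P.lamD i

/-- Fraction of normal (non-blank) resource blocks of a BS in the shared network. -/
def Params.rhoS {M : ℕ} (P : Params M) : ℝ :=
  min ((P.bC * P.lamU + ∑ i, P.bD i * (1 - P.pt i) * P.lamD i) / (P.lamB * P.subbands)) 1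

/-! ## The shared network seen from the typical cellular user -/

/-- The independent sources of randomness: the point process of the BSs, the point process of
each D2D type, and the individual marks of the individual points. -/
inductive Source (M : ℕ) : Type
  | bsPos
  | bsFade (n : ℕ)
  | bsNormal (n : ℕ)
  | d2dPos (i : Fin M)
  | d2dFade (i : Fin M) (n : ℕ)
  | d2dActive (i : Fin M) (n : ℕ)
  | d2dAccess (i : Fin M) (n : ℕ)

/-- The random elements of the network, on one typical resource block. -/
structure Elements (M : ℕ) (Ω : Type*) where
  /-- position of the `n`-th BS -/
  bsPos : ℕ → Ω → Plane
  /-- fading of the link from the `n`-th BS to the typical user -/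
  bsFade : ℕ → Ω → ℝ
  /-- whether the resource block is a normal one (not blank) at the `n`-th BS -/
  bsNormal : ℕ → Ω → Bool
  /-- position of the `n`-th potential D2D transmitter of type `i` -/
  d2dPos : Fin M → ℕ → Ω → Plane
  /-- fading of the link from that transmitter to the typical user -/
  d2dFade : Fin M → ℕ → Ω → ℝ
  /-- whether that transmitter is in D2D mode in the time slot (time hopping) -/
  d2dActive : Fin M → ℕ → Ω → Bool
  /-- whether that transmitter accesses the subband (frequency hopping) -/
  d2dAccess : Fin M → ℕ → Ω → Bool

/-- The σ-algebra generated by a source of randomness. A point process counts as one source. -/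
abbrev Elements.sigma {M : ℕ} {Ω : Type*} (N : Elements M Ω) : Source M → MeasurableSpace Ω
  | .bsPos => MeasurableSpace.comap (fun ω n => N.bsPos n ω) inferInstance
  | .bsFade n => MeasurableSpace.comap (N.bsFade n) inferInstance
  | .bsNormal n => MeasurableSpace.comap (N.bsNormal n) inferInstance
  | .d2dPos i => MeasurableSpace.comap (fun ω n => N.d2dPos i n ω) inferInstance
  | .d2dFade i n => MeasurableSpace.comap (N.d2dFade i n) inferInstance
  | .d2dActive i n => MeasurableSpace.comap (N.d2dActive i n) inferInstance
  | .d2dAccess i n => MeasurableSpace.comap (N.d2dAccess i n) inferInstance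

/-- The model: independent homogeneous Poisson point processes of BSs and of the D2D types,
Rayleigh fading (exponential power of mean one) on all links, independent time and frequency
hopping of the D2D links, and independent thinning of the BSs with retention probability
`rhoS`, all these being mutually independent. -/
structure IsSharedNetwork {M : ℕ} (P : Params M) {Ω : Type*} [MeasurableSpace Ω]
    (μ : Measure Ω) (N : Elements M Ω) : Prop where
  bs_ppp : IsHomogeneousPPP μ P.lamB N.bsPos
  d2d_ppp : ∀ i, IsHomogeneousPPP μ (P.lamD i) (N.d2dPos i)
  bsFade_measurable : ∀ n, Measurable (N.bsFade n)
  bsFade_law : ∀ n, HasLaw (N.bsFade n) (expMeasure 1) μ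
  bsNormal_measurable : ∀ n, Measurable (N.bsNormal n)
  bsNormal_prob : ∀ n, μ.real {ω | N.bsNormal n ω = true} = P.rhoS
  d2dFade_measurable : ∀ i n, Measurable (N.d2dFade i n)
  d2dFade_law : ∀ i n, HasLaw (N.d2dFade i n) (expMeasure 1) μ
  d2dActive_measurable : ∀ i n, Measurable (N.d2dActive i n)
  d2dActive_prob : ∀ i n, μ.real {ω | N.d2dActive i n ω = true} = P.pt i
  d2dAccess_measurable : ∀ i n, Measurable (N.d2dAccess i n)
  d2dAccess_prob : ∀ i n, μ.real {ω | N.d2dAccess i n ω = true} = P.pf i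
  indep : iIndep N.sigma μ

/-- Power received at the origin from a transmitter at `x` with power `p` and fading `h`:
`p h |x|^{-α}`. -/
def receivedPower (α p h : ℝ) (x : Plane) : ℝ≥0∞ :=
  ENNReal.ofReal (p * h) * ‖x‖ₑ ^ (-α)

/-- Index of a point nearest to the origin (the first such index; almost surely there is exactly
one). -/
def nearestIndex (x : ℕ → Plane) : ℕ :=
  sInf {n | ∀ m, ‖x n‖ ≤ ‖x m‖}

namespace Elements

variable {M : ℕ} {Ω : Type*}

/-- Index of the BS that serves the typical user: the nearest one. -/
def serving (N : Elements M Ω) (ω : Ω) : ℕ :=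
  nearestIndex (fun n => N.bsPos n ω)

/-- Distance from the typical user to its serving BS. -/
def servingDist (N : Elements M Ω) (ω : Ω) : ℝ :=
  ‖N.bsPos (N.serving ω) ω‖

/-- Interference from the D2D transmitters that are active in the time slot and access the
subband. -/
def interferenceD (N : Elements M Ω) (P : Params M) (ω : Ω) : ℝ≥0∞ :=
  ∑ i, ∑' n, if N.d2dActive i n ω = true ∧ N.d2dAccess i n ω = true then
    receivedPower P.α P.PD (N.d2dFade i n ω) (N.d2dPos i n ω) else 0

/-- Interference from the transmitting BSs other than the serving one. -/
def interferenceB (N : Elements M Ω) (P : Params M) (ω : Ω) : ℝ≥0∞ :=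
  ∑' n, if n ≠ N.serving ω ∧ N.bsNormal n ω = true then
    receivedPower P.α P.PB (N.bsFade n ω) (N.bsPos n ω) else 0

/-- SINR of the typical cellular user. -/
def sinr (N : Elements M Ω) (P : Params M) (ω : Ω) : ℝ≥0∞ :=
  receivedPower P.α P.PB (N.bsFade (N.serving ω) ω) (N.bsPos (N.serving ω) ω) /
    (N.interferenceD P ω + N.interferenceB P ω + ENNReal.ofReal P.noise)

end Elements

/-! ## Laplace transforms and the quantities of the formula -/

/-- Laplace transform `s ↦ ∫ e^{-s x} ν(dx)` of a measure on `[0, ∞]`, with `e^{-∞} = 0`. -/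
def laplace (ν : Measure ℝ≥0∞) (s : ℝ) : ℝ :=
  ∫ x, (if x = ∞ then 0 else Real.exp (-(s * x.toReal))) ∂ν

/-- Laplace transform of the law of the D2D interference. -/
def laplaceD {M : ℕ} {Ω : Type*} [MeasurableSpace Ω] (P : Params M) (μ : Measure Ω)
    (N : Elements M Ω) (s : ℝ) : ℝ :=
  laplace (μ.map (N.interferenceD P)) s

/-- Laplace transform of the conditional law of the BS interference, given that the serving BS
is at distance `r`. -/
def laplaceB {M : ℕ} {Ω : Type*} [MeasurableSpace Ω] (P : Params M) (μ : Measure Ω)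
    [IsFiniteMeasure μ] (N : Elements M Ω) (r s : ℝ) : ℝ :=
  laplace (condDistrib (N.interferenceB P) N.servingDist μ r) s

/-- `H₁(β, α) = ∫₁^∞ x / (1 + β⁻¹ x^α) dx`. -/
def H1 (β α : ℝ) : ℝ :=
  ∫ x in Ioi (1 : ℝ), x / (1 + β⁻¹ * x ^ α)

/-- The density `2 π λ r e^{-π λ r²}` (for `r > 0`). -/
def nearestDensity (lam r : ℝ) : ℝ :=
  Real.exp (-(lam * Real.pi * r ^ 2)) * (2 * lam * Real.pi * r)

end D2D

end

/-! Since `h₀` is exponential and independent of everything else in the SINR, P(SINR > β) = E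
exp(-s(R)(I_D + I_B + σ²)) (`measure_lt_sinr`). The noise contributes a function of R, and I_D is
independent of (R, I_B), so the theorem reduces to two Laplace transforms: that of I_D, and that of
I_B jointly with R.

Averaging over the fading and the transmission choice of one interferer at distance t, with power P
and transmission probability p, replaces e^{-s · power} by ψ(t) = 1 - p c/(c + t^α), where c = sP
(`attn`). Given the positions, the transform of the interference is therefore a product of ψ over
the points, and the Laplace functional of a Poisson process (`IsHomogeneousPPP.lintegral_nexp_tsum`)
averages such products. For I_D this gives exp(-2πλp ∫₀^∞ t c/(c + t^α) dt) for each type; the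
integral comes from Euler's reflection formula (`lintegral_ratio`).

For I_B the nearest point has to be excluded. No Palm calculus is used. The Laplace functional with
weight ∞ on the disc of radius r yields E[∏ ψ(|X_n|); R > r] = T(r) = exp(-λ(πr² + 2π ∫_r^∞ t(1 -
ψ(t)) dt)), see `tailFun`. Differentiation in r shows that the law of R weighted by the full product
has density 2πλ r ψ(r) T(r), and cancelling the factor ψ(R) of the nearest point leaves the product
over the others, with density 2πλ r T(r). Comparison with the density of R identifies the
conditional transform for almost every r at each fixed s. Rational s and continuity make the
exceptional set independent of s, so s = s(r) may be inserted, and the substitution t = rx produces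
H₁.

Everything is computed in [0, ∞] with `nexp`, the exponential e^{-x} extended by e^{-∞} = 0. Sums
become products without finiteness conditions, so infinite interference needs no separate treatment.
-/

namespace D2D

open Filter Topology

/-! ### The exponential `e^{-x}` on `[0, ∞]` and its inverse. -/

/-- The map `x ↦ e^{-x}` on `[0, ∞]`, with `e^{-∞} = 0`. -/
noncomputable def nexp (x : ℝ≥0∞) : ℝ≥0∞ := EReal.exp (-(x : EReal))

/-- The inverse `y ↦ -log y` of `nexp` on `[0, 1]`. -/
noncomputable def nlog (y : ℝ≥0∞) : ℝ≥0∞ := (-(ENNReal.log y)).toENNReal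

@[simp] lemma nexp_zero : nexp 0 = 1 := by simp [nexp]

@[simp] lemma nexp_top : nexp ∞ = 0 := by simp [nexp]

lemma nexp_antitone : Antitone nexp := fun a b h => by
  unfold nexp
  rw [EReal.exp_le_exp_iff, EReal.neg_le_neg_iff]
  exact_mod_cast h

lemma nexp_le_one (x : ℝ≥0∞) : nexp x ≤ 1 := nexp_zero ▸ nexp_antitone (zero_le (a := x))

lemma nexp_ne_top (x : ℝ≥0∞) : nexp x ≠ ∞ := ((nexp_le_one x).trans_lt ENNReal.one_lt_top).ne

lemma nexp_add (x y : ℝ≥0∞) : nexp (x + y) = nexp x * nexp y := by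
  unfold nexp
  rw [← EReal.exp_add, EReal.coe_ennreal_add, EReal.neg_add, sub_eq_add_neg]
  · left; exact EReal.coe_ennreal_ne_bot x
  · right; exact EReal.coe_ennreal_ne_bot y

lemma continuous_nexp : Continuous nexp :=
  ENNReal.continuous_exp.comp (continuous_neg.comp continuous_coe_ennreal_ereal)

lemma measurable_nexp : Measurable nexp := continuous_nexp.measurable

lemma nexp_ofReal {x : ℝ} (hx : 0 ≤ x) : nexp (ENNReal.ofReal x) = ENNReal.ofReal (Real.exp (-x)) := by
  unfold nexp
  rw [EReal.coe_ennreal_ofReal, max_eq_left hx, ← EReal.coe_neg, EReal.exp_coe]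

lemma nexp_of_ne_top {x : ℝ≥0∞} (hx : x ≠ ∞) : nexp x = ENNReal.ofReal (Real.exp (-x.toReal)) := by
  rw [← nexp_ofReal ENNReal.toReal_nonneg, ENNReal.ofReal_toReal hx]

lemma nexp_sum {ι : Type*} (s : Finset ι) (a : ι → ℝ≥0∞) :
    nexp (∑ i ∈ s, a i) = ∏ i ∈ s, nexp (a i) := by
  classical
  induction s using Finset.induction_on with
  | empty => simp
  | insert i s hi ih => rw [Finset.sum_insert hi, Finset.prod_insert hi, nexp_add, ih]

lemma tendsto_prod_nexp (a : ℕ → ℝ≥0∞) :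
    Tendsto (fun n => ∏ i ∈ Finset.range n, nexp (a i)) atTop (𝓝 (nexp (∑' i, a i))) := by
  simp_rw [← nexp_sum]
  exact (continuous_nexp.tendsto _).comp ENNReal.summable.hasSum.tendsto_sum_nat

/-- With this, a product of factors in [0, 1] over the points of a process is `nexp` of a sum, the
form in which the Laplace functional applies. The bound `y ≤ 1` is needed because `toENNReal`
truncates negative values to 0. -/
lemma nexp_nlog {y : ℝ≥0∞} (hy : y ≤ 1) : nexp (nlog y) = y := by
  unfold nexp nlog
  rw [EReal.coe_toENNReal, neg_neg, ENNReal.exp_log]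
  rw [EReal.le_neg]
  simpa using ENNReal.log_le_log_iff.2 hy

lemma nlog_nexp (x : ℝ≥0∞) : nlog (nexp x) = x := by
  simp [nexp, nlog]

lemma measurable_nlog : Measurable nlog := by
  unfold nlog
  fun_prop

/-! ### Exponential and Poisson laws. -/

/-- Laplace transform of a mean one exponential variable. -/
lemma lintegral_nexp_expMeasure (c : ℝ≥0∞) :
    ∫⁻ h, nexp (ENNReal.ofReal h * c) ∂(expMeasure 1) = (1 + c)⁻¹ := by
  have h0 : ∀ f : ℝ → ℝ≥0∞, Measurable f → ∫⁻ h, f h ∂(expMeasure 1) =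
      ∫⁻ h in Ioi (0 : ℝ), ENNReal.ofReal (Real.exp (-h)) * f h := by
    intro f hf
    have : expMeasure 1 = volume.withDensity (exponentialPDF 1) := rfl
    have hm : Measurable (exponentialPDF 1) := (measurable_exponentialPDFReal 1).ennreal_ofReal
    rw [this, lintegral_withDensity_eq_lintegral_mul _ hm hf,
      ← lintegral_add_compl _ (measurableSet_Ici (a := (0 : ℝ)))]
    have h2 : ∫⁻ h in (Ici (0 : ℝ))ᶜ, (exponentialPDF 1 * f) h = 0 := by
      rw [setLIntegral_congr_fun (g := fun _ => 0) measurableSet_Ici.compl]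
      · simp
      · intro x hx
        simp at hx
        simp [exponentialPDF_of_neg hx]
    rw [h2, add_zero, ← restrict_Ioi_eq_restrict_Ici]
    refine setLIntegral_congr_fun measurableSet_Ioi fun x hx => ?_
    simp [exponentialPDF_of_nonneg (le_of_lt (mem_Ioi.1 hx))]
  rw [h0 _ (by have := measurable_nexp; fun_prop)]
  -- For c = ∞ both sides vanish, because h > 0 on the domain of integration.
  rcases eq_or_ne c ∞ with rfl | hc
  · rw [setLIntegral_congr_fun (g := fun _ => 0) measurableSet_Ioi]
    · simp
    · intro x hx
      simp [ENNReal.mul_top, (mem_Ioi.1 hx)]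
  · lift c to ℝ≥0 using hc
    have hpos : (0 : ℝ) < 1 + c := by positivity
    rw [setLIntegral_congr_fun (g := fun h => ENNReal.ofReal (Real.exp (-(1 + c : ℝ) * h)))
      measurableSet_Ioi]
    · rw [← ofReal_integral_eq_lintegral_ofReal]
      · rw [integral_exp_mul_Ioi (by linarith)]
        simp only [mul_zero, Real.exp_zero]
        rw [neg_div_neg_eq, one_div, ENNReal.ofReal_inv_of_pos hpos, ENNReal.ofReal_add (by simp) (by simp)]
        simp
      · exact integrableOn_exp_mul_Ioi (by linarith) 0
      · exact ae_of_all _ fun _ => (Real.exp_pos _).le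
    · intro h hh
      have hh' : 0 < h := hh
      simp only
      have : ENNReal.ofReal h * (c : ℝ≥0∞) = ENNReal.ofReal (h * c) := by
        rw [ENNReal.ofReal_mul hh'.le]; simp
      rw [this, nexp_ofReal (by positivity), ← ENNReal.ofReal_mul (Real.exp_pos _).le,
        ← Real.exp_add]
      ring_nf

/-- Tail of a mean one exponential variable. -/
lemma expMeasure_tail (y : ℝ≥0∞) :
    expMeasure 1 {h | y < ENNReal.ofReal h} = nexp y := by
  have := isProbabilityMeasure_expMeasure (r := 1) one_pos
  rcases eq_or_ne y ∞ with rfl | hy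
  · simp
  · lift y to ℝ≥0 using hy with x
    have hset : {h : ℝ | (x : ℝ≥0∞) < ENNReal.ofReal h} = (Iic (x : ℝ))ᶜ := by
      ext h
      simp only [mem_ofPred_eq, mem_compl_iff, mem_Iic, not_le]
      rw [← ENNReal.ofReal_coe_nnreal, ENNReal.ofReal_lt_ofReal_iff_of_nonneg x.coe_nonneg]
    rw [hset, prob_compl_eq_one_sub measurableSet_Iic, ← ProbabilityTheory.ofReal_cdf,
      cdf_expMeasure_eq one_pos, if_pos x.coe_nonneg, one_mul, nexp_of_ne_top ENNReal.coe_ne_top,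
      ← ENNReal.ofReal_one, ← ENNReal.ofReal_sub _ (by simp)]
    simp

lemma expMeasure_pos : ∀ᵐ h ∂(expMeasure 1), 0 < h := by
  have := isProbabilityMeasure_expMeasure (r := 1) one_pos
  have := expMeasure_tail 0
  rw [nexp_zero] at this
  have hm : MeasurableSet {h : ℝ | (0 : ℝ≥0∞) < ENNReal.ofReal h} :=
    measurableSet_lt measurable_const ENNReal.measurable_ofReal
  have h2 := (prob_compl_eq_zero_iff hm).2 this
  filter_upwards [compl_mem_ae_iff.2 h2] with h hh
  simpa using hh

/-- Laplace transform of a Poisson variable. -/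
lemma lintegral_nexp_poissonMeasure (t : ℝ≥0) (a : ℝ≥0∞) :
    ∫⁻ k : ℕ, nexp (a * k) ∂(poissonMeasure t) = nexp (t * (1 - nexp a)) := by
  have hz : ∀ k : ℕ, nexp (a * k) = nexp a ^ k := by
    intro k
    induction k with
    | zero => simp
    | succ k ih => rw [Nat.cast_succ, mul_add, nexp_add, ih, mul_one, pow_succ]
  set z : ℝ := (nexp a).toReal with hzdef
  have hz0 : 0 ≤ z := ENNReal.toReal_nonneg
  have hzo : nexp a = ENNReal.ofReal z := (ENNReal.ofReal_toReal (nexp_ne_top a)).symm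
  have hz1 : z ≤ 1 := by
    have := ENNReal.toReal_mono ENNReal.one_ne_top (nexp_le_one a)
    simpa using this
  rw [poissonMeasure, lintegral_sum_measure]
  simp_rw [lintegral_smul_measure, lintegral_dirac, hz, hzo, smul_eq_mul]
  have h1 : (t : ℝ≥0∞) * (1 - ENNReal.ofReal z) = ENNReal.ofReal (t * (1 - z)) := by
    rw [ENNReal.ofReal_mul t.coe_nonneg, ENNReal.ofReal_sub _ hz0]; simp
  rw [h1, nexp_ofReal (mul_nonneg t.coe_nonneg (by linarith))]
  have h2 : HasSum (fun n : ℕ => Real.exp (-t) * t ^ n / (n.factorial) * z ^ n)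
      (Real.exp (-(t * (1 - z)))) := by
    have h3 := (NormedSpace.expSeries_div_hasSum_exp ((t : ℝ) * z)).mul_left (Real.exp (-t))
    rw [← Real.exp_eq_exp_ℝ, ← Real.exp_add] at h3
    have h4 : -(t : ℝ) + t * z = -(t * (1 - z)) := by ring
    rw [h4] at h3
    refine h3.congr_fun fun n => ?_
    rw [mul_pow]; ring
  rw [← h2.tsum_eq, ENNReal.ofReal_tsum_of_nonneg _ h2.summable]
  · refine tsum_congr fun n => ?_
    rw [ENNReal.ofReal_mul (by positivity), ENNReal.ofReal_pow hz0]
  · intro n; positivity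

/-! ### Radial integrals in the plane. -/

/-- Integration in polar coordinates of a radial function on the plane. -/
lemma map_norm_volume : (volume : Measure Plane).map (fun x => ‖x‖) =
    (volume.restrict (Ioi (0 : ℝ))).withDensity (fun r => ENNReal.ofReal (2 * Real.pi * r)) := by
  have hball : ∀ a : ℝ, (volume : Measure Plane).map (fun x => ‖x‖) (Iio a) =
      ENNReal.ofReal a ^ 2 * ENNReal.ofReal Real.pi := by
    intro a
    rw [Measure.map_apply measurable_norm measurableSet_Iio, ← EuclideanSpace.volume_ball_fin_two 0 a]
    congr 1
    ext x; simp
  -- The rays `Iio a` form a generating π-system; on them the identity says πa² = ∫₀^a 2πr dr, both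
  -- sides being 0 for a ≤ 0.
  refine Measure.ext_of_generateFrom_of_iUnion (range Iio) (fun n : ℕ => Iio (n : ℝ))
    (BorelSpace.measurable_eq.trans (borel_eq_generateFrom_Iio ℝ)) isPiSystem_Iio ?_ ?_ ?_ ?_
  · exact eq_univ_of_forall fun x => mem_iUnion.2 (exists_nat_gt x)
  · exact fun n => ⟨n, rfl⟩
  · intro n
    rw [hball]
    finiteness
  · rintro _ ⟨a, rfl⟩
    rw [hball, withDensity_apply _ measurableSet_Iio, Measure.restrict_restrict measurableSet_Iio]
    rcases le_or_gt a 0 with ha | ha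
    · have : Iio a ∩ Ioi 0 = ∅ := by
        ext x; simp; intro h; linarith
      simp [this, ENNReal.ofReal_of_nonpos ha]
    · have : Iio a ∩ Ioi 0 = Ioo 0 a := by ext x; simp [and_comm]
      rw [this, restrict_Ioo_eq_restrict_Ioc, ← ofReal_integral_eq_lintegral_ofReal]
      · rw [← intervalIntegral.integral_of_le ha.le, intervalIntegral.integral_const_mul, integral_id,
          ← ENNReal.ofReal_pow ha.le, ← ENNReal.ofReal_mul (by positivity)]
        congr 1; ring
      · rw [← IntegrableOn, ← intervalIntegrable_iff_integrableOn_Ioc_of_le ha.le]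
        exact (continuous_const.mul continuous_id).intervalIntegrable _ _
      · filter_upwards [ae_restrict_mem measurableSet_Ioc] with x hx
        have := hx.1
        have := Real.pi_pos
        positivity

lemma lintegral_norm {F : ℝ → ℝ≥0∞} (hF : Measurable F) :
    ∫⁻ x : Plane, F ‖x‖ = ∫⁻ r in Ioi (0 : ℝ), ENNReal.ofReal (2 * Real.pi * r) * F r := by
  rw [← lintegral_map hF measurable_norm, map_norm_volume,
    lintegral_withDensity_eq_lintegral_mul _ (by fun_prop) hF]
  rfl

/-! ### Products and Fubini under independence. -/

section Independence

variable {Ω : Type*} {mΩ : MeasurableSpace Ω} {μ : Measure Ω} [IsProbabilityMeasure μ]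
  {ι : Type*} {m : ι → MeasurableSpace Ω}

/-- Induction on the index set: the new factor and the product of the old ones depend on disjoint
groups of independent σ-algebras. -/
lemma lintegral_prod_of_disjoint_groups {κ : Type*} (hle : ∀ i, m i ≤ mΩ) (hind : iIndep m μ)
    {S : κ → Set ι} (hS : Pairwise fun a b => Disjoint (S a) (S b)) {Y : κ → Ω → ℝ≥0∞}
    (hY : ∀ k, Measurable[⨆ i ∈ S k, m i] (Y k)) (s : Finset κ) :
    ∫⁻ ω, ∏ k ∈ s, Y k ω ∂μ = ∏ k ∈ s, ∫⁻ ω, Y k ω ∂μ := by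
  classical
  induction s using Finset.induction_on with
  | empty => simp
  | insert k s hk ih =>
    simp_rw [Finset.prod_insert hk]
    rw [← ih]
    have hd : Disjoint (S k) (⋃ l ∈ s, S l) := by
      rw [disjoint_iUnion₂_right]
      exact fun l hl => hS fun h => hk (h ▸ hl)
    refine lintegral_mul_eq_lintegral_mul_lintegral_of_independent_measurableSpace
      (iSup₂_le fun i _ => hle i) (iSup₂_le fun i _ => hle i)
      (indep_iSup_of_disjoint hle hind hd) (hY k) ?_
    refine Finset.measurable_prod _ fun l hl => (hY l).mono ?_ le_rfl
    exact iSup₂_mono' fun i hi => ⟨i, mem_biUnion hl hi, le_rfl⟩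

/-- The finite products converge and are bounded by 1, so the product formula passes to the limit by
dominated convergence. -/
lemma lintegral_nexp_tsum_of_disjoint_groups (hle : ∀ i, m i ≤ mΩ) (hind : iIndep m μ)
    {S : ℕ → Set ι} (hS : Pairwise fun a b => Disjoint (S a) (S b)) {Y : ℕ → Ω → ℝ≥0∞}
    (hY : ∀ k, Measurable[⨆ i ∈ S k, m i] (Y k)) {g : ℕ → ℝ≥0∞}
    (hg : ∀ k, ∫⁻ ω, nexp (Y k ω) ∂μ = nexp (g k)) :
    ∫⁻ ω, nexp (∑' k, Y k ω) ∂μ = nexp (∑' k, g k) := by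
  have hmeas : ∀ k, Measurable (Y k) := fun k => (hY k).mono (iSup₂_le fun i _ => hle i) le_rfl
  have h1 : Tendsto (fun n => ∫⁻ ω, ∏ k ∈ Finset.range n, nexp (Y k ω) ∂μ) atTop
      (𝓝 (∫⁻ ω, nexp (∑' k, Y k ω) ∂μ)) := by
    refine tendsto_lintegral_of_dominated_convergence (fun _ => 1) (fun n => ?_) (fun n => ?_)
      (by simp) (ae_of_all _ fun ω => tendsto_prod_nexp _)
    · exact Finset.measurable_prod _ fun k _ => measurable_nexp.comp (hmeas k)
    · exact ae_of_all _ fun ω => Finset.prod_le_one' fun k _ => nexp_le_one _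
  refine tendsto_nhds_unique h1 ?_
  have h2 : (fun n => ∫⁻ ω, ∏ k ∈ Finset.range n, nexp (Y k ω) ∂μ) =
      fun n => ∏ k ∈ Finset.range n, nexp (g k) := by
    ext n
    rw [lintegral_prod_of_disjoint_groups hle hind hS (Y := fun k ω => nexp (Y k ω))
      fun k => measurable_nexp.comp (hY k)]
    simp_rw [hg]
  rw [h2]
  exact tendsto_prod_nexp g

end Independence

/-- The joint law is a product, so Tonelli applies. This replaces conditioning on `X`: its value is
frozen while `W` is averaged. -/
lemma lintegral_eq_lintegral_lintegral_of_indep {Ω α β : Type*} [MeasurableSpace α]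
    [MeasurableSpace β] {m₁ m₂ mΩ : MeasurableSpace Ω} {μ : Measure Ω} [IsFiniteMeasure μ] (h₁ : m₁ ≤ mΩ) (h₂ : m₂ ≤ mΩ)
    (hind : Indep m₁ m₂ μ) {X : Ω → α} {W : Ω → β} (hX : Measurable[m₁] X) (hW : Measurable[m₂] W)
    {f : α × β → ℝ≥0∞} (hf : Measurable f) :
    ∫⁻ ω, f (X ω, W ω) ∂μ = ∫⁻ ω, ∫⁻ ω', f (X ω, W ω') ∂μ ∂μ := by
  have hX' : Measurable X := hX.mono h₁ le_rfl
  have hW' : Measurable W := hW.mono h₂ le_rfl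
  have hi : IndepFun X W μ :=
    indep_of_indep_of_le_left (indep_of_indep_of_le_right hind hW.comap_le) hX.comap_le
  rw [← lintegral_map (g := fun ω => (X ω, W ω)) hf (hX'.prodMk hW'),
    (indepFun_iff_map_prod_eq_prod_map_map hX'.aemeasurable hW'.aemeasurable).1 hi,
    lintegral_prod _ hf.aemeasurable, lintegral_map hf.lintegral_prod_right' hX']
  refine lintegral_congr fun ω => ?_
  exact lintegral_map (hf.comp measurable_prodMk_left) hW'

/-! ### The Laplace functional of a Poisson process. -/

section PointProcess

variable {Ω : Type*} [MeasurableSpace Ω] {μ : Measure Ω} {lam : ℝ} {X : ℕ → Ω → Plane}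

lemma measurable_pointCount (hX : ∀ n, Measurable (X n)) {A : Set Plane} (hA : MeasurableSet A) :
    Measurable fun ω => pointCount (fun n => X n ω) A := by
  unfold pointCount
  exact Measurable.tsum fun n => (measurable_const.indicator hA).comp (hX n)

/-- Points are grouped by the value of `f`. The value 0 is left out because its fibre may have
infinite area, where the model says nothing about counts. -/
lemma tsum_simpleFunc (f : SimpleFunc Plane ℝ≥0∞) (x : ℕ → Plane) :
    ∑' n, f (x n) = ∑ a ∈ f.range.erase 0, a * pointCount x (f ⁻¹' {a}) := by
  classical
  simp_rw [pointCount, ← ENNReal.tsum_mul_left]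
  rw [← Summable.tsum_finsetSum fun _ _ => ENNReal.summable]
  refine tsum_congr fun n => ?_
  have h : ∀ a, a * (f ⁻¹' {a}).indicator (fun _ => (1 : ℝ≥0∞)) (x n) =
      if a = f (x n) then a else 0 := by
    intro a
    by_cases h : f (x n) = a
    · simp [h]
    · simp [h, Ne.symm h]
  simp_rw [h]
  rw [Finset.sum_ite_eq']
  split_ifs with h0
  · rfl
  · simpa using h0

lemma IsHomogeneousPPP.lintegral_nexp_count (hX : IsHomogeneousPPP μ lam X) {A : Set Plane}
    (hA : MeasurableSet A) (hv : volume A ≠ ∞) (a : ℝ≥0∞) :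
    ∫⁻ ω, nexp (a * pointCount (fun n => X n ω) A) ∂μ =
      nexp (ENNReal.ofReal lam * ((1 - nexp a) * volume A)) := by
  have h := hX.count_law A hA hv
  have hm : Measurable fun y : ℝ≥0∞ => nexp (a * y) := measurable_nexp.comp (measurable_id.const_mul a)
  have h1 := lintegral_map' (μ := μ) (f := fun y : ℝ≥0∞ => nexp (a * y)) hm.aemeasurable h.aemeasurable
  rw [← h1, h.map_eq, lintegral_map hm .of_discrete, lintegral_nexp_poissonMeasure]
  congr 1
  rw [ENNReal.coe_mul, ENNReal.coe_toNNReal hv, mul_assoc, mul_comm (volume A)]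
  rfl

/-- The fibres over nonzero values are disjoint and of finite area, so the counts are independent
Poisson variables and the transform is a product of Poisson transforms. -/
lemma IsHomogeneousPPP.lintegral_nexp_simpleFunc (hX : IsHomogeneousPPP μ lam X)
    (f : SimpleFunc Plane ℝ≥0∞) (hf : ∀ a, a ≠ 0 → volume (f ⁻¹' {a}) ≠ ∞) :
    ∫⁻ ω, nexp (∑' n, f (X n ω)) ∂μ =
      nexp (ENNReal.ofReal lam * ∫⁻ x, (1 - nexp (f x))) := by
  classical
  simp_rw [tsum_simpleFunc]
  set s := f.range.erase 0 with hs
  set e := s.equivFin.symm with he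
  have hsum : ∀ F : ℝ≥0∞ → ℝ≥0∞, ∑ a ∈ s, F a = ∑ i, F (e i) := by
    intro F
    rw [← Finset.sum_coe_sort s F]
    exact (Equiv.sum_comp e fun a : s => F a).symm
  have hne : ∀ i, (e i : ℝ≥0∞) ≠ 0 := fun i => (Finset.mem_erase.1 (e i).2).1
  have hms : ∀ a, MeasurableSet (f ⁻¹' {a}) := fun a => f.measurableSet_fiber a
  have hind := hX.count_indep s.card (fun i => f ⁻¹' {(e i : ℝ≥0∞)}) (fun i => hms _)
    (fun i => hf _ (hne i)) (by
      intro i j hij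
      refine Disjoint.preimage _ (disjoint_singleton.2 fun h => hij (e.injective (Subtype.ext h))))
  have hind2 := hind.comp (fun i y => nexp ((e i : ℝ≥0∞) * y))
    fun i => measurable_nexp.comp (measurable_id.const_mul _)
  simp_rw [hsum, nexp_sum]
  have h3 := lintegral_prod_eq_prod_lintegral_of_indepFun Finset.univ _ hind2 fun i =>
    (measurable_nexp.comp (measurable_id.const_mul _)).comp
      (measurable_pointCount hX.measurable (hms _))
  simp only [Function.comp_def] at h3
  rw [h3]
  simp_rw [hX.lintegral_nexp_count (hms _) (hf _ (hne _))]
  rw [← nexp_sum, ← hsum fun a => ENNReal.ofReal lam * ((1 - nexp a) * volume (f ⁻¹' {a})),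
    ← Finset.mul_sum]
  congr 2
  have h4 : (fun x => 1 - nexp (f x)) = f.map fun a => 1 - nexp a := rfl
  rw [h4, SimpleFunc.lintegral_eq_lintegral, SimpleFunc.map_lintegral, hs]
  refine Finset.sum_erase _ (by simp)

/-- The Laplace functional of a homogeneous Poisson point process. -/
lemma IsHomogeneousPPP.lintegral_nexp_tsum [IsProbabilityMeasure μ] (hX : IsHomogeneousPPP μ lam X)
    {g : Plane → ℝ≥0∞} (hg : Measurable g) :
    ∫⁻ ω, nexp (∑' n, g (X n ω)) ∂μ =
      nexp (ENNReal.ofReal lam * ∫⁻ x, (1 - nexp (g x))) := by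
  -- Restriction to the ball of radius k gives all nonzero fibres finite area, and is harmless in
  -- the limit at any given point.
  set f : ℕ → SimpleFunc Plane ℝ≥0∞ :=
    fun k => (SimpleFunc.eapprox g k).restrict (Metric.ball 0 k) with hfdef
  have hf : ∀ k x, f k x = (Metric.ball (0 : Plane) k).indicator (SimpleFunc.eapprox g k) x :=
    fun k x => SimpleFunc.restrict_apply _ Metric.isOpen_ball.measurableSet x
  have hmono : ∀ x, Monotone fun k => f k x := by
    intro x i j hij
    simp only [hf]
    refine (indicator_le_indicator (SimpleFunc.monotone_eapprox g hij x)).trans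
      (indicator_le_indicator_of_subset (Metric.ball_subset_ball (by exact_mod_cast hij))
        (fun _ => zero_le) x)
  have hlim : ∀ x, Tendsto (fun k => f k x) atTop (𝓝 (g x)) := by
    intro x
    refine (SimpleFunc.tendsto_eapprox hg x).congr' ?_
    obtain ⟨N, hN⟩ := exists_nat_gt ‖x‖
    filter_upwards [eventually_ge_atTop N] with k hk
    rw [hf, indicator_of_mem]
    rw [mem_ball_zero_iff]
    exact hN.trans_le (by exact_mod_cast hk)
  have hvol : ∀ k a, a ≠ 0 → volume (f k ⁻¹' {a}) ≠ ∞ := by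
    intro k a ha
    refine ne_top_of_le_ne_top (measure_ball_lt_top (μ := volume) (x := (0 : Plane)) (r := k)).ne
      (measure_mono fun x hx => ?_)
    by_contra h
    have h1 : f k x = a := hx
    rw [hf, indicator_of_notMem h] at h1
    exact ha h1.symm
  have hL : Tendsto (fun k => ∫⁻ ω, nexp (∑' n, f k (X n ω)) ∂μ) atTop
      (𝓝 (∫⁻ ω, nexp (∑' n, g (X n ω)) ∂μ)) := by
    refine tendsto_lintegral_of_dominated_convergence (fun _ => 1) (fun k => ?_) (fun k => ?_)
      (by simp) (ae_of_all _ fun ω => (continuous_nexp.tendsto _).comp ?_)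
    · exact measurable_nexp.comp (Measurable.tsum fun n =>
        (f k).measurable.comp (hX.measurable n))
    · exact ae_of_all _ fun ω => nexp_le_one _
    -- The sum over the points is an integral against counting measure, so monotone convergence
    -- applies to it.
    · simp_rw [← lintegral_count]
      exact lintegral_tendsto_of_tendsto_of_monotone (fun k => .of_discrete)
        (ae_of_all _ fun n => hmono _) (ae_of_all _ fun n => hlim _)
  refine tendsto_nhds_unique hL ?_
  simp_rw [fun k => hX.lintegral_nexp_simpleFunc (f k) (hvol k)]
  refine (continuous_nexp.tendsto _).comp (ENNReal.Tendsto.const_mul ?_ (.inr ENNReal.ofReal_ne_top))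
  refine lintegral_tendsto_of_tendsto_of_monotone (fun k => ?_) (ae_of_all _ fun x => ?_)
    (ae_of_all _ fun x => ?_)
  · exact (measurable_const.sub (measurable_nexp.comp (f k).measurable)).aemeasurable
  · intro i j hij
    exact tsub_le_tsub_left (nexp_antitone (hmono x hij)) _
  · exact ENNReal.Tendsto.sub tendsto_const_nhds ((continuous_nexp.tendsto _).comp (hlim x))
      (.inl ENNReal.one_ne_top)

/-- Balls almost surely contain finitely many indexed points. Hence only finitely many are
candidates for being at least as close as the point of index 0, and one of them is nearest. -/
lemma IsHomogeneousPPP.ae_exists_nearest (hX : IsHomogeneousPPP μ lam X) :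
    ∀ᵐ ω ∂μ, ∃ n, ∀ k, ‖X n ω‖ ≤ ‖X k ω‖ := by
  have h : ∀ N : ℕ, ∀ᵐ ω ∂μ, pointCount (fun n => X n ω) (Metric.closedBall 0 N) ≠ ∞ := by
    intro N
    have hl := hX.count_law (Metric.closedBall 0 N) Metric.isClosed_closedBall.measurableSet
      measure_closedBall_lt_top.ne
    have hm : MeasurableSet {y : ℝ≥0∞ | y ≠ ∞} := (measurableSet_singleton ∞).compl
    refine (ae_map_iff hl.aemeasurable hm).1 ?_
    rw [hl.map_eq, ae_map_iff .of_discrete hm]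
    exact ae_of_all _ fun k => ENNReal.natCast_ne_top k
  filter_upwards [ae_all_iff.2 h] with ω hω
  obtain ⟨N, hN⟩ := exists_nat_ge ‖X 0 ω‖
  have hfin : {n | ‖X n ω‖ ≤ N}.Finite := by
    refine (ENNReal.finite_const_le_of_tsum_ne_top (hω N) one_ne_zero).subset fun n hn => ?_
    have : X n ω ∈ Metric.closedBall (0 : Plane) N := by simpa using hn
    simp [this]
  obtain ⟨n, hn, hmin⟩ := hfin.exists_minimalFor (fun n => ‖X n ω‖) _ ⟨0, hN⟩
  refine ⟨n, fun k => ?_⟩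
  rcases le_total ‖X k ω‖ ‖X n ω‖ with hk | hk
  · exact hmin (show ‖X k ω‖ ≤ N from hk.trans hn) hk
  · exact hk

end PointProcess

/-! ### Measurability of the nearest point. -/

section Nearest

/-- Distance from the origin to the nearest point of a sequence. -/
noncomputable def nearestDist (x : ℕ → Plane) : ℝ := ‖x (nearestIndex x)‖

lemma measurable_nearestIndex : Measurable nearestIndex := by
  have hm : ∀ n, MeasurableSet {x : ℕ → Plane | ∀ k, ‖x n‖ ≤ ‖x k‖} := by
    intro n
    have : {x : ℕ → Plane | ∀ k, ‖x n‖ ≤ ‖x k‖} = ⋂ k, {x | ‖x n‖ ≤ ‖x k‖} := by ext; simp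
    rw [this]
    exact MeasurableSet.iInter fun k => measurableSet_le
      (measurable_norm.comp (measurable_pi_apply n)) (measurable_norm.comp (measurable_pi_apply k))
  refine measurable_of_Iic fun n => ?_
  -- The second set collects the sequences without a nearest point: there `sInf ∅ = 0` puts the
  -- index into every `Iic n`.
  have : nearestIndex ⁻¹' Iic n = (⋃ k ∈ Iic n, {x : ℕ → Plane | ∀ l, ‖x k‖ ≤ ‖x l‖}) ∪
      (⋂ k, {x : ℕ → Plane | ∀ l, ‖x k‖ ≤ ‖x l‖}ᶜ) := by
    ext x
    simp only [mem_preimage, mem_Iic, mem_union, mem_iUnion, mem_iInter, mem_compl_iff]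
    constructor
    · intro h
      by_cases he : ∃ k, ∀ l, ‖x k‖ ≤ ‖x l‖
      · exact .inl ⟨nearestIndex x, h, Nat.sInf_mem (s := {n | ∀ m, ‖x n‖ ≤ ‖x m‖}) he⟩
      · exact .inr fun k hk => he ⟨k, hk⟩
    · rintro (⟨k, hk, h⟩ | h)
      · exact (Nat.sInf_le (s := {n | ∀ m, ‖x n‖ ≤ ‖x m‖}) h).trans hk
      · have : {n | ∀ m, ‖x n‖ ≤ ‖x m‖} = ∅ := by
          ext k; simpa using h k
        simp [nearestIndex, this]
  rw [this]
  exact (MeasurableSet.biUnion (to_countable _) fun k _ => hm k).union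
    (MeasurableSet.iInter fun k => (hm k).compl)

lemma measurable_nearestDist : Measurable nearestDist := by
  have h : Measurable fun p : (ℕ → Plane) × ℕ => ‖p.1 p.2‖ :=
    measurable_from_prod_countable_left fun n => measurable_norm.comp (measurable_pi_apply n)
  have h2 : Measurable fun x : ℕ → Plane => (x, nearestIndex x) :=
    measurable_id.prodMk measurable_nearestIndex
  have h3 := h.comp h2
  exact h3

lemma nearestDist_nonneg (x : ℕ → Plane) : 0 ≤ nearestDist x := norm_nonneg _

lemma nearestDist_le {x : ℕ → Plane} (h : ∃ n, ∀ k, ‖x n‖ ≤ ‖x k‖) (k : ℕ) :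
    nearestDist x ≤ ‖x k‖ :=
  Nat.sInf_mem (s := {n | ∀ m, ‖x n‖ ≤ ‖x m‖}) h k

end Nearest

/-! ### Joint law of the nearest distance and of a product over the points. -/

/-- Joint survival function of the distance to the nearest point and of the attenuation `1 - ψ`
averaged over the points of a Poisson process beyond that distance. -/
noncomputable def tailFun (lam : ℝ) (ψ : ℝ → ℝ) (r : ℝ) : ℝ :=
  Real.exp (-(lam * (Real.pi * r ^ 2 + 2 * Real.pi * ∫ t in Ioi r, t * (1 - ψ t))))

section Tail

variable {lam : ℝ} {ψ : ℝ → ℝ}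

/-- Expressing the tail integral through a primitive makes the function visibly differentiable in
`r`. -/
lemma tailFun_eq (hψi : IntegrableOn (fun t => t * (1 - ψ t)) (Ioi 0)) {r : ℝ} (hr : 0 ≤ r) :
    tailFun lam ψ r = Real.exp (-(lam * (Real.pi * r ^ 2 + 2 * Real.pi *
      ((∫ t in Ioi 0, t * (1 - ψ t)) - ∫ t in (0 : ℝ)..r, t * (1 - ψ t))))) := by
  rw [tailFun, ← intervalIntegral.integral_Ioi_sub_Ioi hψi hr]
  ring_nf

/-- The integrand is minus the derivative of `tailFun`: in the exponent, πr² contributes 2πt and the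
tail integral -2πt(1 - ψ t), which add up to 2πtψ t. The boundary term at infinity vanishes, since
exp(-λπr²) is an upper bound. -/
lemma lintegral_tailFun (hlam : 0 < lam) (hc : Continuous ψ) (h0 : ∀ r, 0 ≤ r → 0 ≤ ψ r)
    (h1 : ∀ r, 0 ≤ r → ψ r ≤ 1) (hψi : IntegrableOn (fun t => t * (1 - ψ t)) (Ioi 0))
    {r : ℝ} (hr : 0 ≤ r) :
    ∫⁻ t in Ioi r, ENNReal.ofReal (2 * Real.pi * lam * t * ψ t * tailFun lam ψ t) =
      ENNReal.ofReal (tailFun lam ψ r) := by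
  have hpi := Real.pi_pos
  set I : ℝ := ∫ t in Ioi 0, t * (1 - ψ t) with hI
  set G : ℝ → ℝ := fun r => Real.exp (-(lam * (Real.pi * r ^ 2 + 2 * Real.pi *
      (I - ∫ t in (0 : ℝ)..r, t * (1 - ψ t))))) with hG
  have hGt : ∀ t, 0 ≤ t → tailFun lam ψ t = G t := fun t ht => tailFun_eq hψi ht
  have hd : ∀ t, HasDerivAt G (-(2 * Real.pi * lam * t * ψ t * G t)) t := by
    intro t
    have hf : Continuous fun t => t * (1 - ψ t) := by fun_prop
    have := hf.integral_hasStrictDerivAt 0 t |>.hasDerivAt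
    have h2 := ((((hasDerivAt_pow 2 t).const_mul Real.pi).add
      ((this.const_sub I).const_mul (2 * Real.pi))).const_mul lam).neg.exp
    refine h2.congr_deriv ?_
    simp only [hG, Pi.add_apply, Pi.neg_apply, Nat.cast_ofNat]
    ring
  have hlim : Tendsto G atTop (𝓝 0) := by
    have hA : Tendsto (fun r : ℝ => Real.exp (-(lam * (Real.pi * r ^ 2)))) atTop (𝓝 0) := by
      refine Real.tendsto_exp_neg_atTop_nhds_zero.comp ?_
      exact ((tendsto_pow_atTop two_ne_zero).const_mul_atTop hpi).const_mul_atTop hlam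
    refine squeeze_zero' (.of_forall fun r => (Real.exp_pos _).le) ?_ hA
    filter_upwards [eventually_ge_atTop 0] with r hr
    rw [← hGt r hr, tailFun]
    refine Real.exp_le_exp.2 (neg_le_neg (mul_le_mul_of_nonneg_left ?_ hlam.le))
    have : 0 ≤ ∫ t in Ioi r, t * (1 - ψ t) :=
      setIntegral_nonneg measurableSet_Ioi fun t ht => by
        have ht0 : 0 ≤ t := hr.trans (le_of_lt ht)
        exact mul_nonneg ht0 (sub_nonneg.2 (h1 t ht0))
    nlinarith
  have hneg : ∀ t ∈ Ioi r, -(2 * Real.pi * lam * t * ψ t * G t) ≤ 0 := by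
    intro t ht
    have ht0 : 0 ≤ t := hr.trans (le_of_lt ht)
    have := h0 t ht0
    have : 0 ≤ G t := (Real.exp_pos _).le
    rw [neg_nonpos]
    positivity
  have hint := integral_Ioi_of_hasDerivAt_of_nonpos' (fun t _ => hd t) hneg hlim
  have hin := integrableOn_Ioi_deriv_of_nonpos' (fun t _ => hd t) hneg hlim
  rw [hGt r hr, setLIntegral_congr_fun
    (g := fun t => ENNReal.ofReal (2 * Real.pi * lam * t * ψ t * G t)) measurableSet_Ioi,
    ← ofReal_integral_eq_lintegral_ofReal]
  · rw [integral_neg, zero_sub, neg_inj] at hint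
    rw [hint]
  · have := hin.neg
    simp only [IntegrableOn, Pi.neg_def, neg_neg] at this
    exact this
  · filter_upwards [ae_restrict_mem measurableSet_Ioi] with t ht
    simpa using hneg t ht
  · intro t ht
    simp only
    rw [hGt t (hr.trans (le_of_lt ht))]

lemma aemeasurable_tailFun (hc : Continuous ψ)
    (hψi : IntegrableOn (fun t => t * (1 - ψ t)) (Ioi 0)) :
    AEMeasurable (tailFun lam ψ) (volume.restrict (Ioi 0)) := by
  have hf : Continuous fun t => t * (1 - ψ t) := by fun_prop
  have hp : Continuous fun r => ∫ t in (0 : ℝ)..r, t * (1 - ψ t) :=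
    intervalIntegral.continuous_primitive (fun a b => hf.intervalIntegrable a b) 0
  refine ⟨fun r => Real.exp (-(lam * (Real.pi * r ^ 2 + 2 * Real.pi *
      ((∫ t in Ioi 0, t * (1 - ψ t)) - ∫ t in (0 : ℝ)..r, t * (1 - ψ t))))), ?_, ?_⟩
  · exact Continuous.measurable (by fun_prop)
  · filter_upwards [ae_restrict_mem measurableSet_Ioi] with t ht
    exact tailFun_eq hψi (le_of_lt ht)

variable {Ω : Type*} [MeasurableSpace Ω] {μ : Measure Ω} {X : ℕ → Ω → Plane}

lemma IsHomogeneousPPP.measurable_seq (hX : IsHomogeneousPPP μ lam X) :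
    Measurable fun ω n => X n ω := measurable_pi_lambda _ hX.measurable

variable [IsProbabilityMeasure μ]

/-- A weight ∞ on the closed disc of radius `r` annihilates every configuration with a point there.
The Laplace functional of that weight is therefore the expectation of the product on the event that
the nearest distance exceeds `r`. -/
lemma IsHomogeneousPPP.lintegral_nexp_tsum_nearestDist_gt (hlam : 0 < lam)
    (hX : IsHomogeneousPPP μ lam X) (hc : Continuous ψ) (h0 : ∀ r, 0 ≤ r → 0 ≤ ψ r)
    (h1 : ∀ r, 0 ≤ r → ψ r ≤ 1) (hψi : IntegrableOn (fun t => t * (1 - ψ t)) (Ioi 0))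
    {r : ℝ} (hr : 0 ≤ r) :
    ∫⁻ ω in {ω | r < nearestDist fun n => X n ω},
      nexp (∑' n, nlog (ENNReal.ofReal (ψ ‖X n ω‖))) ∂μ = ENNReal.ofReal (tailFun lam ψ r) := by
  have hpi := Real.pi_pos
  set g : Plane → ℝ≥0∞ := fun x => if ‖x‖ ≤ r then ∞ else nlog (ENNReal.ofReal (ψ ‖x‖)) with hg
  have hgm : Measurable g := by
    refine Measurable.ite (measurableSet_le measurable_norm measurable_const) measurable_const ?_
    exact measurable_nlog.comp (ENNReal.measurable_ofReal.comp (hc.measurable.comp measurable_norm))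
  have hms : MeasurableSet {ω | r < nearestDist fun n => X n ω} :=
    measurableSet_lt measurable_const (measurable_nearestDist.comp hX.measurable_seq)
  have hL := hX.lintegral_nexp_tsum hgm
  rw [← lintegral_indicator hms]
  have hae : (fun ω => {ω | r < nearestDist fun n => X n ω}.indicator
      (fun ω => nexp (∑' n, nlog (ENNReal.ofReal (ψ ‖X n ω‖)))) ω) =ᵐ[μ]
      fun ω => nexp (∑' n, g (X n ω)) := by
    filter_upwards [hX.ae_exists_nearest] with ω hω
    by_cases h : r < nearestDist fun n => X n ω
    · rw [indicator_of_mem (by exact h)]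
      congr 1
      refine tsum_congr fun n => ?_
      have := h.trans_le (nearestDist_le (x := fun n => X n ω) hω n)
      simp [hg, not_le.2 this]
    · rw [indicator_of_notMem (by exact h)]
      have : g (X (nearestIndex fun n => X n ω) ω) = ∞ := by
        exact if_pos (not_lt.1 h)
      rw [ENNReal.tsum_eq_top_of_eq_top (f := fun n => g (X n ω)) ⟨_, this⟩, nexp_top]
  rw [lintegral_congr_ae hae, hL]
  -- The intensity integrand is 1 on the disc, contributing its area πr², and 1 - ψ outside.
  set F : ℝ → ℝ≥0∞ := fun t => if t ≤ r then 1 else ENNReal.ofReal (1 - ψ t) with hF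
  have hFm : Measurable F := Measurable.ite measurableSet_Iic measurable_const
    (ENNReal.measurable_ofReal.comp (measurable_const.sub hc.measurable))
  have hgF : ∀ x, 1 - nexp (g x) = F ‖x‖ := by
    intro x
    by_cases h : ‖x‖ ≤ r
    · simp [hg, hF, h]
    · simp only [hg, hF, h, if_false]
      rw [nexp_nlog (by simpa using h1 _ (norm_nonneg x)),
        ENNReal.ofReal_sub _ (h0 _ (norm_nonneg x)), ENNReal.ofReal_one]
  simp_rw [hgF]
  rw [lintegral_norm hFm, ← Ioc_union_Ioi_eq_Ioi hr,
    lintegral_union measurableSet_Ioi (Ioc_disjoint_Ioi le_rfl)]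
  have e1 : ∫⁻ t in Ioc 0 r, ENNReal.ofReal (2 * Real.pi * t) * F t =
      ENNReal.ofReal (Real.pi * r ^ 2) := by
    rw [setLIntegral_congr_fun (g := fun t => ENNReal.ofReal (2 * Real.pi * t)) measurableSet_Ioc]
    · rw [← ofReal_integral_eq_lintegral_ofReal]
      · rw [← intervalIntegral.integral_of_le hr, intervalIntegral.integral_const_mul, integral_id]
        congr 1; ring
      · rw [← IntegrableOn, ← intervalIntegrable_iff_integrableOn_Ioc_of_le hr]
        exact (continuous_const.mul continuous_id).intervalIntegrable _ _
      · filter_upwards [ae_restrict_mem measurableSet_Ioc] with x hx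
        have := hx.1
        positivity
    · intro t ht
      simp [hF, ht.2]
  have hnn : ∀ t ∈ Ioi r, 0 ≤ t * (1 - ψ t) := fun t ht => by
    have ht0 : 0 ≤ t := hr.trans (le_of_lt ht)
    exact mul_nonneg ht0 (sub_nonneg.2 (h1 t ht0))
  have e2 : ∫⁻ t in Ioi r, ENNReal.ofReal (2 * Real.pi * t) * F t =
      ENNReal.ofReal (2 * Real.pi * ∫ t in Ioi r, t * (1 - ψ t)) := by
    rw [setLIntegral_congr_fun (g := fun t => ENNReal.ofReal (2 * Real.pi * (t * (1 - ψ t))))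
      measurableSet_Ioi]
    · rw [← ofReal_integral_eq_lintegral_ofReal, integral_const_mul]
      · exact (hψi.mono_set (Ioi_subset_Ioi hr)).const_mul _
      · filter_upwards [ae_restrict_mem measurableSet_Ioi] with t ht
        exact mul_nonneg (by positivity) (hnn t ht)
    · intro t ht
      have ht0 : 0 ≤ t := hr.trans (le_of_lt ht)
      simp only [hF, not_le.2 (mem_Ioi.1 ht), if_false]
      rw [← ENNReal.ofReal_mul (by positivity), mul_assoc]
  have hA : 0 ≤ ∫ t in Ioi r, t * (1 - ψ t) := setIntegral_nonneg measurableSet_Ioi hnn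
  rw [e1, e2, ← ENNReal.ofReal_add (by positivity) (by positivity), ← ENNReal.ofReal_mul hlam.le,
    nexp_ofReal (by positivity)]
  rfl

lemma tailFun_one (r : ℝ) : tailFun lam (fun _ => 1) r = Real.exp (-(lam * Real.pi * r ^ 2)) := by
  simp [tailFun, mul_assoc]

/-- This is the survival formula with ψ = 1 and r = 0, whose right side is 1. -/
lemma IsHomogeneousPPP.ae_nearestDist_pos (hlam : 0 < lam) (hX : IsHomogeneousPPP μ lam X) :
    ∀ᵐ ω ∂μ, 0 < nearestDist fun n => X n ω := by
  have h := hX.lintegral_nexp_tsum_nearestDist_gt hlam (ψ := fun _ => 1) continuous_const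
    (fun _ _ => zero_le_one) (fun _ _ => le_rfl) (by simp) le_rfl
  have hz : nlog 1 = 0 := by rw [← nexp_zero, nlog_nexp]
  have hms : MeasurableSet {ω | 0 < nearestDist fun n => X n ω} :=
    measurableSet_lt measurable_const (measurable_nearestDist.comp hX.measurable_seq)
  simp [hz, tailFun_one] at h
  exact (mem_ae_iff_prob_eq_one hms).2 h

/-- Law of the distance to the nearest point, weighted by a product over all the points. -/
lemma IsHomogeneousPPP.map_nearestDist_withDensity (hlam : 0 < lam)
    (hX : IsHomogeneousPPP μ lam X) (hc : Continuous ψ) (h0 : ∀ r, 0 ≤ r → 0 ≤ ψ r)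
    (h1 : ∀ r, 0 ≤ r → ψ r ≤ 1) (hψi : IntegrableOn (fun t => t * (1 - ψ t)) (Ioi 0)) :
    (μ.withDensity fun ω => nexp (∑' n, nlog (ENNReal.ofReal (ψ ‖X n ω‖)))).map
      (fun ω => nearestDist fun n => X n ω) =
    (volume.restrict (Ioi 0)).withDensity
      fun t => ENNReal.ofReal (2 * Real.pi * lam * t * ψ t * tailFun lam ψ t) := by
  set W : Ω → ℝ≥0∞ := fun ω => nexp (∑' n, nlog (ENNReal.ofReal (ψ ‖X n ω‖))) with hW
  have hRm : Measurable fun ω => nearestDist fun n => X n ω :=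
    measurable_nearestDist.comp hX.measurable_seq
  have hfin : IsFiniteMeasure (μ.withDensity W) := by
    refine isFiniteMeasure_withDensity (ne_top_of_le_ne_top ENNReal.one_ne_top ?_)
    refine (lintegral_mono fun ω => nexp_le_one _).trans ?_
    simp
  have hzero : (μ.withDensity W).map (fun ω => nearestDist fun n => X n ω) univ =
      ENNReal.ofReal (tailFun lam ψ 0) := by
    rw [Measure.map_apply hRm .univ, preimage_univ, withDensity_apply _ .univ,
      ← hX.lintegral_nexp_tsum_nearestDist_gt hlam hc h0 h1 hψi le_rfl]
    refine setLIntegral_congr ?_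
    filter_upwards [hX.ae_nearestDist_pos hlam] with ω hω
    exact propext ⟨fun _ => hω, fun _ => trivial⟩
  have hfull : ((volume.restrict (Ioi 0)).withDensity
      fun t => ENNReal.ofReal (2 * Real.pi * lam * t * ψ t * tailFun lam ψ t)) univ =
      ENNReal.ofReal (tailFun lam ψ 0) := by
    rw [withDensity_apply _ .univ, Measure.restrict_univ,
      lintegral_tailFun hlam hc h0 h1 hψi le_rfl]
  -- On the rays `Ioi r` with r ≥ 0 both measures equal `tailFun` at r. For r < 0 both have full
  -- mass, which is the value at 0 because the nearest distance is almost surely positive.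
  refine ext_of_generate_finite (range Ioi)
    (BorelSpace.measurable_eq.trans (borel_eq_generateFrom_Ioi ℝ)) isPiSystem_Ioi ?_
    (hzero.trans hfull.symm)
  rintro _ ⟨r, rfl⟩
  rcases lt_or_ge r 0 with hr | hr
  · have e1 : (μ.withDensity W).map (fun ω => nearestDist fun n => X n ω) (Ioi r) =
        (μ.withDensity W).map (fun ω => nearestDist fun n => X n ω) univ := by
      rw [Measure.map_apply hRm measurableSet_Ioi, Measure.map_apply hRm .univ]
      congr 1
      ext ω
      simpa using hr.trans_le (nearestDist_nonneg _)
    rw [e1, hzero, withDensity_apply _ measurableSet_Ioi,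
      Measure.restrict_restrict measurableSet_Ioi,
      inter_eq_self_of_subset_right (Ioi_subset_Ioi hr.le),
      lintegral_tailFun hlam hc h0 h1 hψi le_rfl]
  · rw [Measure.map_apply hRm measurableSet_Ioi, withDensity_apply _ (hRm measurableSet_Ioi),
      withDensity_apply _ measurableSet_Ioi, Measure.restrict_restrict measurableSet_Ioi,
      inter_eq_self_of_subset_left (Ioi_subset_Ioi hr), lintegral_tailFun hlam hc h0 h1 hψi hr,
      ← hX.lintegral_nexp_tsum_nearestDist_gt hlam hc h0 h1 hψi hr]
    rfl

/-- Joint law of the distance to the nearest point and of a product over the other points. -/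
lemma IsHomogeneousPPP.lintegral_nearestDist_mul_nexp (hlam : 0 < lam)
    (hX : IsHomogeneousPPP μ lam X) (hc : Continuous ψ) (h0 : ∀ r, 0 ≤ r → 0 ≤ ψ r)
    (hpos : ∀ r, 0 < r → 0 < ψ r)
    (h1 : ∀ r, 0 ≤ r → ψ r ≤ 1) (hψi : IntegrableOn (fun t => t * (1 - ψ t)) (Ioi 0))
    {F : ℝ → ℝ≥0∞} (hF : Measurable F) :
    ∫⁻ ω, F (nearestDist fun n => X n ω) * nexp (∑' n, if n = nearestIndex (fun n => X n ω) then 0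
      else nlog (ENNReal.ofReal (ψ ‖X n ω‖))) ∂μ =
    ∫⁻ t in Ioi 0, F t * ENNReal.ofReal (2 * Real.pi * lam * t * tailFun lam ψ t) := by
  have hpi := Real.pi_pos
  set W : Ω → ℝ≥0∞ := fun ω => nexp (∑' n, nlog (ENNReal.ofReal (ψ ‖X n ω‖))) with hW
  have hRm : Measurable fun ω => nearestDist fun n => X n ω :=
    measurable_nearestDist.comp hX.measurable_seq
  have hWm : Measurable W := measurable_nexp.comp (Measurable.tsum fun n =>
    measurable_nlog.comp (ENNReal.measurable_ofReal.comp (hc.measurable.comp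
      (measurable_norm.comp (hX.measurable n)))))
  -- The weight `W` runs over all points; the inverse removes the factor ψ(R) of the nearest one,
  -- which is nonzero because R > 0 almost surely.
  set H : ℝ → ℝ≥0∞ := fun t => F t * (ENNReal.ofReal (ψ t))⁻¹ with hH
  have hHm : Measurable H := hF.mul (ENNReal.measurable_ofReal.comp hc.measurable).inv
  have hcancel : ∀ t, 0 < t → (ENNReal.ofReal (ψ t))⁻¹ * ENNReal.ofReal (ψ t) = 1 := fun t ht =>
    ENNReal.inv_mul_cancel (by simpa using hpos t ht) ENNReal.ofReal_ne_top
  have hae : (fun ω => F (nearestDist fun n => X n ω) *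
      nexp (∑' n, if n = nearestIndex (fun n => X n ω) then 0
        else nlog (ENNReal.ofReal (ψ ‖X n ω‖)))) =ᵐ[μ]
      (W * fun ω => H (nearestDist fun n => X n ω)) := by
    filter_upwards [hX.ae_nearestDist_pos hlam] with ω hω
    set R := nearestDist fun n => X n ω with hR
    have e : W ω = ENNReal.ofReal (ψ R) * nexp (∑' n, if n = nearestIndex (fun n => X n ω) then 0
        else nlog (ENNReal.ofReal (ψ ‖X n ω‖))) := by
      simp only [hW]
      rw [ENNReal.tsum_eq_add_tsum_ite (nearestIndex fun n => X n ω), nexp_add, nexp_nlog]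
      · congr!
      · simpa using h1 _ (norm_nonneg _)
    rw [Pi.mul_apply, e]
    simp only [hH, ← hR]
    calc _ = F R * nexp _ * ((ENNReal.ofReal (ψ R))⁻¹ * ENNReal.ofReal (ψ R)) := by
          rw [hcancel R hω, mul_one]
      _ = _ := by ring
  have e2 := lintegral_withDensity_eq_lintegral_mul μ hWm (hHm.comp hRm)
  simp only [Function.comp_def] at e2
  rw [lintegral_congr_ae hae, ← e2,
    ← lintegral_map (f := H) hHm hRm, hX.map_nearestDist_withDensity hlam hc h0 h1 hψi,
    lintegral_withDensity_eq_lintegral_mul₀ _ hHm.aemeasurable]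
  · refine setLIntegral_congr_fun measurableSet_Ioi fun t ht => ?_
    have ht0 : 0 < t := ht
    simp only [Pi.mul_apply, hH]
    have : 2 * Real.pi * lam * t * ψ t * tailFun lam ψ t =
      ψ t * (2 * Real.pi * lam * t * tailFun lam ψ t) := by ring
    rw [this, ENNReal.ofReal_mul (h0 t ht0.le)]
    calc _ = F t * ENNReal.ofReal (2 * Real.pi * lam * t * tailFun lam ψ t) *
          ((ENNReal.ofReal (ψ t))⁻¹ * ENNReal.ofReal (ψ t)) := by ring
      _ = _ := by rw [hcancel t ht0, mul_one]
  · have := aemeasurable_tailFun (lam := lam) hc hψi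
    have := hc.measurable
    fun_prop

lemma IsHomogeneousPPP.map_nearestDist (hlam : 0 < lam) (hX : IsHomogeneousPPP μ lam X) :
    μ.map (fun ω => nearestDist fun n => X n ω) =
      (volume.restrict (Ioi 0)).withDensity fun r => ENNReal.ofReal (nearestDensity lam r) := by
  have h := hX.map_nearestDist_withDensity hlam (ψ := fun _ => 1) continuous_const
    (fun _ _ => zero_le_one) (fun _ _ => le_rfl) (by simp)
  have hz : nlog 1 = 0 := by rw [← nexp_zero, nlog_nexp]
  simp only [ENNReal.ofReal_one, hz, tsum_zero, nexp_zero, tailFun_one] at h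
  rw [← Pi.one_def, withDensity_one] at h
  rw [h]
  congr 1
  ext r
  rw [nearestDensity]
  ring_nf

end Tail

/-! ### The attenuation function and its integrals. -/

/-- Mean attenuation caused by a Rayleigh faded interferer at distance `t` that transmits with
probability `p`. -/
noncomputable def attn (p c α t : ℝ) : ℝ := 1 - p * (c / (c + |t| ^ α))

section Attn

variable {p c α : ℝ}

lemma one_sub_attn (t : ℝ) : 1 - attn p c α t = p * (c / (c + |t| ^ α)) := by simp [attn]

/-- The absolute value in `attn` keeps the denominator positive on the whole line, although only `t
≥ 0` has a meaning. -/
lemma continuous_attn (hc : 0 < c) (hα : 2 < α) : Continuous (attn p c α) := by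
  have h1 : Continuous fun t : ℝ => |t| ^ α := continuous_abs.rpow_const fun _ => .inr (by linarith)
  refine continuous_const.sub (continuous_const.mul (continuous_const.div (continuous_const.add h1) ?_))
  intro t
  have : 0 ≤ |t| ^ α := by positivity
  positivity

lemma ratio_le_one (hc : 0 < c) (t : ℝ) : c / (c + |t| ^ α) ≤ 1 := by
  have : 0 ≤ |t| ^ α := by positivity
  rw [div_le_one (by positivity)]
  linarith

lemma attn_nonneg (hc : 0 < c) (hp : p ∈ Icc (0 : ℝ) 1) (t : ℝ) : 0 ≤ attn p c α t := by
  have h0 : 0 ≤ c / (c + |t| ^ α) := by positivity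
  have := mul_le_mul hp.2 (ratio_le_one (α := α) hc t) h0 zero_le_one
  unfold attn
  linarith

/-- Off the origin the ratio is strictly below 1, so positivity persists for p = 1. For α > 0 the
value at the origin is 1 - p, hence the restriction to t > 0. -/
lemma attn_pos (hc : 0 < c) (hp : p ∈ Icc (0 : ℝ) 1) {t : ℝ} (ht : 0 < t) : 0 < attn p c α t := by
  have h1 : 0 < |t| ^ α := by have := abs_pos.2 ht.ne'; positivity
  have h0 : 0 ≤ c / (c + |t| ^ α) := by positivity
  have h2 : c / (c + |t| ^ α) < 1 := by rw [div_lt_one (by positivity)]; linarith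
  have := mul_le_mul_of_nonneg_right hp.2 h0
  unfold attn
  linarith

lemma attn_le_one (hc : 0 < c) (hp : p ∈ Icc (0 : ℝ) 1) (t : ℝ) : attn p c α t ≤ 1 := by
  have h0 : 0 ≤ c / (c + |t| ^ α) := by positivity
  have := mul_nonneg hp.1 h0
  unfold attn
  linarith

/-- Write c/(c + t^α) = ∫₀^∞ c e^{-(c + t^α)u} du and apply Tonelli. The t-integral gives Γ(2/α),
the u-integral then gives Γ(1 - 2/α), finite because α > 2, and the reflection formula evaluates
their product. -/
lemma lintegral_ratio (hc : 0 < c) (hα : 2 < α) :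
    ∫⁻ t in Ioi (0 : ℝ), ENNReal.ofReal (t * (c / (c + |t| ^ α))) =
      ENNReal.ofReal (c ^ (2 / α) * (Real.pi / α / Real.sin (2 * Real.pi / α))) := by
  have hα0 : 0 < α := by linarith
  have h2α : 2 / α < 1 := by rw [div_lt_one hα0]; exact hα
  have h2α0 : 0 < 2 / α := by positivity
  have e1 : ∀ t ∈ Ioi (0 : ℝ), ENNReal.ofReal (t * (c / (c + |t| ^ α))) =
      ∫⁻ u in Ioi (0 : ℝ), ENNReal.ofReal (t * c * Real.exp (-(c + t ^ α) * u)) := by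
    intro t ht
    have ht0 : 0 < t := ht
    have hpos : 0 < c + t ^ α := by positivity
    rw [← ofReal_integral_eq_lintegral_ofReal, integral_const_mul, integral_exp_mul_Ioi (by linarith)]
    · congr 1
      rw [abs_of_pos ht0, mul_zero, Real.exp_zero, neg_div_neg_eq]
      ring
    · exact (integrableOn_exp_mul_Ioi (by linarith) 0).const_mul _
    · exact ae_of_all _ fun u => by positivity
  rw [setLIntegral_congr_fun measurableSet_Ioi e1, lintegral_lintegral_swap]
  · have e2 : ∀ u ∈ Ioi (0 : ℝ), ∫⁻ t in Ioi (0 : ℝ), ENNReal.ofReal (t * c * Real.exp (-(c + t ^ α) * u)) =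
        ENNReal.ofReal (c * (1 / α) * Real.Gamma (2 / α) * (u ^ ((1 - 2 / α) - 1) * Real.exp (-(c * u)))) := by
      intro u hu
      have hu0 : 0 < u := hu
      have i1 := integral_rpow_mul_exp_neg_mul_rpow hα0 (q := 1) (by norm_num) hu0
      have i2 := integrableOn_rpow_mul_exp_neg_mul_rpow (s := 1) (by norm_num) (p := α) (by linarith) hu0
      have e3 : ∀ t : ℝ, t * c * Real.exp (-(c + t ^ α) * u) =
          c * Real.exp (-(c * u)) * (t ^ (1 : ℝ) * Real.exp (-u * t ^ α)) := by
        intro t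
        have : -(c + t ^ α) * u = -(c * u) + -u * t ^ α := by ring
        rw [this, Real.exp_add, Real.rpow_one]; ring
      simp_rw [e3]
      rw [← ofReal_integral_eq_lintegral_ofReal, integral_const_mul, i1]
      · congr 1
        have : -(1 + 1) / α = (1 - 2 / α) - 1 := by ring
        rw [this]
        norm_num
        ring
      · exact i2.const_mul _
      · filter_upwards [ae_restrict_mem measurableSet_Ioi] with t ht
        have : 0 < t := ht
        positivity
    have hG := Real.Gamma_pos_of_pos h2α0
    rw [setLIntegral_congr_fun measurableSet_Ioi e2, ← ofReal_integral_eq_lintegral_ofReal,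
      integral_const_mul, Real.integral_rpow_mul_exp_neg_mul_Ioi (by linarith) hc]
    · congr 1
      have hr := Real.Gamma_mul_Gamma_one_sub (2 / α)
      have h5 : c * (1 / c) ^ (1 - 2 / α) = c ^ (2 / α) := by
        rw [one_div, Real.inv_rpow hc.le, ← Real.rpow_neg hc.le]
        nth_rewrite 1 [← Real.rpow_one c]
        rw [← Real.rpow_add hc]
        congr 1; ring
      have h6 : Real.pi * (2 / α) = 2 * Real.pi / α := by ring
      rw [h6] at hr
      calc _ = (c * (1 / c) ^ (1 - 2 / α)) * ((1 / α) * (Real.Gamma (2 / α) * Real.Gamma (1 - 2 / α))) := by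
            ring
        _ = _ := by rw [h5, hr]; ring
    · have := integrableOn_rpow_mul_exp_neg_mul_rpow (s := 1 - 2 / α - 1) (p := 1) (by linarith)
        zero_lt_one hc
      simp only [Real.rpow_one, neg_mul] at this
      exact this.const_mul _
    · filter_upwards [ae_restrict_mem measurableSet_Ioi] with u hu
      have : 0 < u := hu
      positivity
  · refine Measurable.aemeasurable ?_
    unfold Function.uncurry
    fun_prop

lemma integrableOn_ratio (hc : 0 < c) (hα : 2 < α) :
    IntegrableOn (fun t => t * (c / (c + |t| ^ α))) (Ioi 0) := by
  have hm : Continuous fun t : ℝ => t * (c / (c + |t| ^ α)) := by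
    have := continuous_id.mul ((continuous_const (y := (1 : ℝ))).sub (continuous_attn (p := 1) hc hα))
    refine this.congr fun t => ?_
    simp [one_sub_attn (p := 1) (c := c) (α := α) t]
  refine ⟨hm.aestronglyMeasurable, ?_⟩
  rw [hasFiniteIntegral_iff_ofReal, lintegral_ratio hc hα]
  · finiteness
  · filter_upwards [ae_restrict_mem measurableSet_Ioi] with t ht
    have : 0 < t := ht
    positivity

lemma integrableOn_mul_one_sub_attn (hc : 0 < c) (hα : 2 < α) :
    IntegrableOn (fun t => t * (1 - attn p c α t)) (Ioi 0) := by
  have h : IntegrableOn (fun t => p * (t * (c / (c + |t| ^ α)))) (Ioi 0) :=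
    (integrableOn_ratio hc hα).const_mul p
  refine h.congr_fun (fun t _ => ?_) measurableSet_Ioi
  simp only [one_sub_attn]; ring

lemma integral_mul_one_sub_attn (hc : 0 < c) (hα : 2 < α) :
    ∫ t in Ioi 0, t * (1 - attn p c α t) =
      p * (c ^ (2 / α) * (Real.pi / α / Real.sin (2 * Real.pi / α))) := by
  have hα0 : 0 < α := by linarith
  have h2α : 2 / α < 1 := by rw [div_lt_one hα0]; exact hα
  have hs : 0 < Real.sin (2 * Real.pi / α) := by
    have hpi := Real.pi_pos
    refine Real.sin_pos_of_pos_of_lt_pi (by positivity) ?_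
    have : 2 * Real.pi / α = 2 / α * Real.pi := by ring
    rw [this]
    nlinarith
  have hpi := Real.pi_pos
  have : ∀ t, t * (1 - attn p c α t) = p * (t * (c / (c + |t| ^ α))) := fun t => by
    rw [one_sub_attn]; ring
  simp_rw [this]
  rw [integral_const_mul, integral_eq_lintegral_of_nonneg_ae, lintegral_ratio hc hα,
    ENNReal.toReal_ofReal (by positivity)]
  · filter_upwards [ae_restrict_mem measurableSet_Ioi] with t ht
    have : 0 < t := ht
    positivity
  · exact (integrableOn_ratio hc hα).aestronglyMeasurable

/-- For c = βr^α the substitution t = rx cancels `r` from the ratio. -/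
lemma integral_Ioi_mul_one_sub_attn {β r : ℝ} (hβ : 0 < β) (hr : 0 < r) :
    ∫ t in Ioi r, t * (1 - attn p (β * r ^ α) α t) = p * (r ^ 2 * H1 β α) := by
  have h := integral_comp_mul_left_Ioi (fun t => t * (1 - attn p (β * r ^ α) α t)) 1 hr
  rw [mul_one] at h
  have h2 : ∫ t in Ioi r, t * (1 - attn p (β * r ^ α) α t) =
      r * ∫ x in Ioi (1 : ℝ), r * x * (1 - attn p (β * r ^ α) α (r * x)) := by
    rw [h, smul_eq_mul, mul_inv_cancel_left₀ hr.ne']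
  rw [h2, H1]
  have e : ∀ x ∈ Ioi (1 : ℝ), r * x * (1 - attn p (β * r ^ α) α (r * x)) =
      p * r * (x / (1 + β⁻¹ * x ^ α)) := by
    intro x hx
    have hx0 : 0 < x := zero_lt_one.trans hx
    have h1 : 0 < r ^ α := by positivity
    have h3 : 0 < x ^ α := by positivity
    rw [one_sub_attn, abs_of_pos (by positivity), Real.mul_rpow hr.le hx0.le]
    field_simp
  rw [setIntegral_congr_fun measurableSet_Ioi e, integral_const_mul]
  ring

/-- The first factor is the probability that no point lies within `r`; the second becomes the
conditional Laplace transform of the interference from beyond `r`. -/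
lemma tailFun_attn {β r lam : ℝ} (hβ : 0 < β) (hr : 0 < r) :
    tailFun lam (attn p (β * r ^ α) α) r =
      Real.exp (-(lam * Real.pi * r ^ 2)) *
        Real.exp (-(2 * Real.pi * p * lam * r ^ 2 * H1 β α)) := by
  rw [tailFun, integral_Ioi_mul_one_sub_attn hβ hr, ← Real.exp_add]
  ring_nf

/-- The ratio c/(c + t^α) increases with c, so along a sequence below the limit the integrands are
dominated by the limiting one. -/
lemma tendsto_tailFun_attn {lam r : ℝ} (hα : 2 < α) (hr : 0 ≤ r) {u : ℕ → ℝ} (hc : 0 < c)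
    (hu0 : ∀ n, 0 < u n) (hu : Tendsto u atTop (𝓝 c)) (hub : ∀ n, u n ≤ c) :
    Tendsto (fun n => tailFun lam (attn p (u n) α) r) atTop (𝓝 (tailFun lam (attn p c α) r)) := by
  have hI : Tendsto (fun n => ∫ t in Ioi r, t * (1 - attn p (u n) α t)) atTop
      (𝓝 (∫ t in Ioi r, t * (1 - attn p c α t))) := by
    refine tendsto_integral_of_dominated_convergence (fun t => |p| * (t * (c / (c + |t| ^ α))))
      (fun n => ?_) ?_ (fun n => ?_) ?_
    · exact ((integrableOn_mul_one_sub_attn (hu0 n) hα).mono_set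
        (Ioi_subset_Ioi hr)).aestronglyMeasurable
    · exact ((integrableOn_ratio hc hα).mono_set (Ioi_subset_Ioi hr)).const_mul _
    · filter_upwards [ae_restrict_mem measurableSet_Ioi] with t ht
      have ht0 : 0 < t := hr.trans_lt ht
      have hn := hu0 n
      have hd : 0 ≤ |t| ^ α := by positivity
      rw [one_sub_attn, mul_left_comm, norm_mul, Real.norm_eq_abs,
        Real.norm_of_nonneg (by positivity)]
      gcongr |p| * (t * ?_)
      rw [div_le_div_iff₀ (by positivity) (by positivity)]
      nlinarith [hub n]
    · filter_upwards [ae_restrict_mem measurableSet_Ioi] with t ht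
      simp_rw [one_sub_attn]
      have hd : 0 ≤ |t| ^ α := by positivity
      exact ((hu.div (hu.add_const _) (by positivity)).const_mul _).const_mul _
  unfold tailFun
  exact (Real.continuous_exp.tendsto _).comp
    (((hI.const_mul _).const_add _).const_mul _).neg

/-- Laplace transform of the power received from an interferer that transmits with
probability `p`. -/
lemma attn_eq {P : ℝ} {s : ℝ} (hs : 0 < s) (hP : 0 < P) (hα : 2 < α) (hp : p ∈ Icc (0 : ℝ) 1)
    (x : Plane) :
    ENNReal.ofReal (1 - p) + ENNReal.ofReal p *
      (1 + ENNReal.ofReal s * (ENNReal.ofReal P * ‖x‖ₑ ^ (-α)))⁻¹ =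
      ENNReal.ofReal (attn p (s * P) α ‖x‖) := by
  have hα0 : 0 < α := by linarith
  rcases eq_or_ne x 0 with rfl | hx
  -- At the origin the path loss is ∞, the inverse vanishes, and both sides are 1 - p.
  · have h1 : (0 : ℝ) < s * P := by positivity
    have : attn p (s * P) α ‖(0 : Plane)‖ = 1 - p := by
      simp [attn, Real.zero_rpow hα0.ne', hs.ne', hP.ne']
    rw [this]
    simp [hα0, hs, hP, ENNReal.mul_top]
  · have hx0 : 0 < ‖x‖ := norm_pos_iff.2 hx
    have e1 : ‖x‖ₑ ^ (-α) = ENNReal.ofReal (‖x‖ ^ (-α)) := by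
      rw [← ofReal_norm, ENNReal.ofReal_rpow_of_pos hx0]
    have hpos : 0 < ‖x‖ ^ (-α) := by positivity
    have hpos2 : 0 < ‖x‖ ^ α := by positivity
    rw [e1, ← ENNReal.ofReal_mul hP.le, ← ENNReal.ofReal_mul hs.le, ← ENNReal.ofReal_one,
      ← ENNReal.ofReal_add zero_le_one (by positivity), ← ENNReal.ofReal_inv_of_pos (by positivity),
      ← ENNReal.ofReal_mul hp.1, ← ENNReal.ofReal_add (sub_nonneg.2 hp.2)
        (mul_nonneg hp.1 (by positivity))]
    congr 1
    rw [attn, abs_of_pos hx0, Real.rpow_neg hx0.le]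
    field_simp
    ring

end Attn

/-! ### Power received from a single interferer. -/

lemma measurable_receivedPower (α p : ℝ) :
    Measurable fun q : ℝ × Plane => receivedPower α p q.1 q.2 := by
  unfold receivedPower
  fun_prop

lemma mul_receivedPower {α p : ℝ} (hp : 0 ≤ p) (c : ℝ≥0∞) (h : ℝ) (x : Plane) :
    c * receivedPower α p h x =
      ENNReal.ofReal h * (c * (ENNReal.ofReal p * ‖x‖ₑ ^ (-α))) := by
  unfold receivedPower
  rw [ENNReal.ofReal_mul hp]
  ring

/-- Laplace transform of the power received from a Rayleigh faded interferer that transmits on the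
event `E`. -/
lemma lintegral_nexp_receivedPower {Ω : Type*} {m₁ m₂ mΩ : MeasurableSpace Ω} {μ : Measure Ω}
    [IsProbabilityMeasure μ] (h₁ : m₁ ≤ mΩ) (h₂ : m₂ ≤ mΩ) (hind : Indep m₁ m₂ μ)
    {E : Set Ω} [DecidablePred (· ∈ E)] (hE : MeasurableSet[m₁] E) {h : Ω → ℝ} (hh : Measurable[m₂] h)
    (hl : HasLaw h (expMeasure 1) μ) {α p s q : ℝ} (hs : 0 < s) (hp : 0 < p) (hα : 2 < α)
    (hq : μ.real E = q) (x : Plane) :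
    ∫⁻ ω, nexp (if ω ∈ E then ENNReal.ofReal s * receivedPower α p (h ω) x else 0) ∂μ =
      ENNReal.ofReal (attn q (s * p) α ‖x‖) := by
  have hq' : q ∈ Icc (0 : ℝ) 1 := hq ▸ ⟨measureReal_nonneg, measureReal_le_one⟩
  have hE' : MeasurableSet E := h₁ _ hE
  set c := ENNReal.ofReal s * (ENNReal.ofReal p * ‖x‖ₑ ^ (-α)) with hc
  have hfm : Measurable fun y : ℝ => nexp (ENNReal.ofReal y * c) :=
    measurable_nexp.comp (ENNReal.measurable_ofReal.mul_const c)
  -- A silent interferer contributes the factor 1; on `E` the indicator and the fading factor are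
  -- independent.
  have hdec : ∀ ω, nexp (if ω ∈ E then ENNReal.ofReal s * receivedPower α p (h ω) x else 0) =
      Eᶜ.indicator 1 ω + E.indicator 1 ω * nexp (ENNReal.ofReal (h ω) * c) := by
    intro ω
    by_cases hω : ω ∈ E
    · simp [hω, mul_receivedPower hp.le, hc]
    · simp [hω]
  have hμE : μ E = ENNReal.ofReal q := by rw [← hq, ofReal_measureReal]
  have hμE' : μ Eᶜ = ENNReal.ofReal (1 - q) := by
    rw [prob_compl_eq_one_sub hE', hμE, ENNReal.ofReal_sub _ hq'.1, ENNReal.ofReal_one]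
  have hI : Measurable[m₁] (E.indicator (1 : Ω → ℝ≥0∞)) := by
    refine Measurable.indicator ?_ hE
    exact measurable_const
  simp_rw [hdec]
  change ∫⁻ ω, Eᶜ.indicator 1 ω + E.indicator 1 ω * ((fun y => nexp (ENNReal.ofReal y * c)) ∘ h) ω ∂μ = _
  rw [lintegral_add_left (measurable_one.indicator hE'.compl),
    lintegral_mul_eq_lintegral_mul_lintegral_of_independent_measurableSpace h₁ h₂ hind
      hI (hfm.comp hh),
    lintegral_indicator_one hE'.compl, lintegral_indicator_one hE', hμE, hμE']
  have := lintegral_map' (μ := μ) (f := fun y : ℝ => nexp (ENNReal.ofReal y * c))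
    hfm.aemeasurable hl.aemeasurable
  rw [hl.map_eq, lintegral_nexp_expMeasure] at this
  simp only [Function.comp_def]
  rw [← this, hc, attn_eq hs hp hα hq']

/-! ### The σ-algebras generated by groups of sources. -/

namespace IsSharedNetwork

variable {M : ℕ} {P : Params M} {Ω : Type*} [mΩ : MeasurableSpace Ω] {μ : Measure Ω}
  {N : Elements M Ω}

lemma sigma_le (hN : IsSharedNetwork P μ N) : ∀ j, N.sigma j ≤ mΩ
  | .bsPos => (hN.bs_ppp.measurable_seq).comap_le
  | .bsFade n => (hN.bsFade_measurable n).comap_le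
  | .bsNormal n => (hN.bsNormal_measurable n).comap_le
  | .d2dPos i => (hN.d2d_ppp i).measurable_seq.comap_le
  | .d2dFade i n => (hN.d2dFade_measurable i n).comap_le
  | .d2dActive i n => (hN.d2dActive_measurable i n).comap_le
  | .d2dAccess i n => (hN.d2dAccess_measurable i n).comap_le

end IsSharedNetwork

section Generated

variable {M : ℕ} {Ω : Type*} (N : Elements M Ω) {S : Set (Source M)}

/-- The σ-algebra generated by a set of sources of randomness. -/
abbrev Elements.sigmaOf (S : Set (Source M)) : MeasurableSpace Ω := ⨆ j ∈ S, N.sigma j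

variable {N}

lemma Elements.sigma_le_sigmaOf {j : Source M} (hj : j ∈ S) : N.sigma j ≤ N.sigmaOf S :=
  le_iSup₂_of_le j hj le_rfl

lemma Elements.measurable_bsPos (h : .bsPos ∈ S) :
    Measurable[N.sigmaOf S] fun ω n => N.bsPos n ω :=
  Measurable.of_comap_le (Elements.sigma_le_sigmaOf h)

lemma Elements.measurable_bsFade {n : ℕ} (h : .bsFade n ∈ S) : Measurable[N.sigmaOf S] (N.bsFade n) :=
  Measurable.of_comap_le (Elements.sigma_le_sigmaOf h)

lemma Elements.measurable_bsNormal {n : ℕ} (h : .bsNormal n ∈ S) :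
    Measurable[N.sigmaOf S] (N.bsNormal n) :=
  Measurable.of_comap_le (Elements.sigma_le_sigmaOf h)

lemma Elements.measurable_d2dPos {i : Fin M} (h : .d2dPos i ∈ S) :
    Measurable[N.sigmaOf S] fun ω n => N.d2dPos i n ω :=
  Measurable.of_comap_le (Elements.sigma_le_sigmaOf h)

lemma Elements.measurable_d2dFade {i : Fin M} {n : ℕ} (h : .d2dFade i n ∈ S) :
    Measurable[N.sigmaOf S] (N.d2dFade i n) :=
  Measurable.of_comap_le (Elements.sigma_le_sigmaOf h)

lemma Elements.measurable_d2dActive {i : Fin M} {n : ℕ} (h : .d2dActive i n ∈ S) :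
    Measurable[N.sigmaOf S] (N.d2dActive i n) :=
  Measurable.of_comap_le (Elements.sigma_le_sigmaOf h)

lemma Elements.measurable_d2dAccess {i : Fin M} {n : ℕ} (h : .d2dAccess i n ∈ S) :
    Measurable[N.sigmaOf S] (N.d2dAccess i n) :=
  Measurable.of_comap_le (Elements.sigma_le_sigmaOf h)

end Generated

namespace IsSharedNetwork

variable {M : ℕ} {P : Params M} {Ω : Type*} [mΩ : MeasurableSpace Ω] {μ : Measure Ω}
  {N : Elements M Ω}

lemma sigmaOf_le (hN : IsSharedNetwork P μ N) (S : Set (Source M)) : N.sigmaOf S ≤ mΩ :=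
  iSup₂_le fun j _ => hN.sigma_le j

lemma indep_sigmaOf (hN : IsSharedNetwork P μ N) {S T : Set (Source M)} (h : Disjoint S T) :
    Indep (N.sigmaOf S) (N.sigmaOf T) μ :=
  indep_iSup_of_disjoint hN.sigma_le hN.indep h

end IsSharedNetwork

/-! ### Interference from given points with random marks. -/

/-- Interference from the points `x` with marks `w` (the fading and whether the point transmits),
the points excluded by `e` not being counted. -/
noncomputable def markedInterference (α p : ℝ) (e : ℕ → Prop) (x : ℕ → Plane)
    (w : ℕ → ℝ × Bool) : ℝ≥0∞ :=
  open Classical in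
  ∑' n, if ¬ e n ∧ (w n).2 = true then receivedPower α p (w n).1 (x n) else 0

/-- Marks of points that are always excluded need not be measurable. Hence, for fixed positions, the
interference does not involve the fading of the serving BS. -/
lemma measurable_markedInterference {α p : ℝ} {Ω : Type*} [MeasurableSpace Ω] {e : Ω → ℕ → Prop}
    {x : Ω → ℕ → Plane} {w : Ω → ℕ → ℝ × Bool} (he : ∀ n, MeasurableSet {ω | e ω n})
    (hx : ∀ n, Measurable fun ω => x ω n) (hw : ∀ n, ¬ (∀ ω, e ω n) → Measurable fun ω => w ω n) :
    Measurable fun ω => markedInterference α p (e ω) (x ω) (w ω) := by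
  classical
  unfold markedInterference
  refine Measurable.tsum fun n => ?_
  by_cases h : ∀ ω, e ω n
  · simp [h]
  · have hw' := hw n h
    refine Measurable.ite ?_ ((measurable_receivedPower α p).comp (hw'.fst.prodMk (hx n)))
      measurable_const
    exact (he n).compl.inter (hw'.snd (measurableSet_singleton true))

lemma mul_markedInterference {α p : ℝ} (c : ℝ≥0∞) (e : ℕ → Prop) [DecidablePred e] (x : ℕ → Plane)
    (w : ℕ → ℝ × Bool) : c * markedInterference α p e x w =
      ∑' n, if ¬ e n ∧ (w n).2 = true then c * receivedPower α p (w n).1 (x n) else 0 := by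
  rw [markedInterference, ← ENNReal.tsum_mul_left]
  refine tsum_congr fun n => ?_
  by_cases h : ¬ e n ∧ (w n).2 = true <;> simp [h]

/-- Laplace transform of the interference from given points with independent marks. -/
lemma lintegral_nexp_markedInterference {Ω : Type*} {mΩ : MeasurableSpace Ω} {μ : Measure Ω}
    [IsProbabilityMeasure μ] {ι : Type*} {m : ι → MeasurableSpace Ω} (hle : ∀ i, m i ≤ mΩ)
    (hind : iIndep m μ) {S T : ℕ → Set ι}
    (hST : Pairwise fun a b => Disjoint (S a ∪ T a) (S b ∪ T b)) (hd : ∀ n, Disjoint (S n) (T n))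
    {h : ℕ → Ω → ℝ} {t : ℕ → Ω → Bool} (hh : ∀ n, Measurable[⨆ i ∈ T n, m i] (h n))
    (ht : ∀ n, Measurable[⨆ i ∈ S n, m i] (t n)) (hl : ∀ n, HasLaw (h n) (expMeasure 1) μ)
    {α p s q : ℝ} (hs : 0 < s) (hp : 0 < p) (hα : 2 < α) (hq : ∀ n, μ.real {ω | t n ω = true} = q)
    (e : ℕ → Prop) [DecidablePred e] (x : ℕ → Plane) :
    ∫⁻ ω, nexp (ENNReal.ofReal s * markedInterference α p e x fun n => (h n ω, t n ω)) ∂μ =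
      nexp (∑' n, if e n then 0 else nlog (ENNReal.ofReal (attn q (s * p) α ‖x n‖))) := by
  have hq' : q ∈ Icc (0 : ℝ) 1 := hq 0 ▸ ⟨measureReal_nonneg, measureReal_le_one⟩
  simp_rw [mul_markedInterference]
  have hSm : ∀ n, (⨆ i ∈ S n, m i) ≤ ⨆ i ∈ S n ∪ T n, m i := fun n =>
    biSup_mono fun i hi => .inl hi
  have hTm : ∀ n, (⨆ i ∈ T n, m i) ≤ ⨆ i ∈ S n ∪ T n, m i := fun n =>
    biSup_mono fun i hi => .inr hi
  refine lintegral_nexp_tsum_of_disjoint_groups hle hind hST (fun n => ?_) fun n => ?_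
  · have h1 := (hh n).mono (hTm n) le_rfl
    have h2 := (ht n).mono (hSm n) le_rfl
    refine Measurable.ite ?_ ?_ measurable_const
    · exact (MeasurableSet.const (¬ e n)).inter (h2 (measurableSet_singleton true))
    · exact ((measurable_receivedPower α p).comp (h1.prodMk measurable_const)).const_mul _
  · by_cases he : e n
    · simp [he]
    · simp only [he, not_false_eq_true, true_and, if_false]
      rw [nexp_nlog (by simpa using attn_le_one (by positivity) hq' _)]
      exact lintegral_nexp_receivedPower (E := {ω | t n ω = true}) (iSup₂_le fun i _ => hle i)
        (iSup₂_le fun i _ => hle i) (indep_iSup_of_disjoint hle hind (hd n))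
        (ht n (measurableSet_singleton true)) (hh n) (hl n) hs hp hα (hq n) (x n)

/-! ### The sources that determine each interference term. -/

namespace IsSharedNetwork

section Generated

variable {M : ℕ} {P : Params M} {Ω : Type*} {N : Elements M Ω}

/-- The sources of randomness that determine the interference of one D2D type. -/
def typeSources (i : Fin M) : Set (Source M) :=
  {j | j = .d2dPos i ∨ ∃ n, j = .d2dFade i n ∨ j = .d2dActive i n ∨ j = .d2dAccess i n}

/-- The sources of randomness that belong to the D2D transmitters. -/
def d2dSources : Set (Source M) := ⋃ i, typeSources i

/-- The positions and the marks of the BSs. -/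
def bsSources : Set (Source M) :=
  {j | j = .bsPos ∨ ∃ n, j = .bsFade n ∨ j = .bsNormal n}

/-- The marks of one D2D type are generated by the corresponding sources. -/
lemma _root_.D2D.Elements.measurable_d2dMarks {i : Fin M} {S : Set (Source M)}
    (h1 : ∀ n, .d2dFade i n ∈ S) (h2 : ∀ n, .d2dActive i n ∈ S) (h3 : ∀ n, .d2dAccess i n ∈ S) :
    Measurable[N.sigmaOf S] fun ω n =>
      (N.d2dFade i n ω, N.d2dActive i n ω && N.d2dAccess i n ω) := by
  refine @measurable_pi_lambda _ _ _ (N.sigmaOf S) _ _ fun n => ?_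
  have h5 : Measurable fun b : Bool × Bool => b.1 && b.2 := .of_discrete
  exact (Elements.measurable_d2dFade (h1 n)).prodMk (h5.comp
    ((Elements.measurable_d2dActive (h2 n)).prodMk (Elements.measurable_d2dAccess (h3 n))))

/-- The marks of the BSs are generated by the corresponding sources. -/
lemma _root_.D2D.Elements.measurable_bsMarks {S : Set (Source M)}
    (h1 : ∀ n, .bsFade n ∈ S) (h2 : ∀ n, .bsNormal n ∈ S) :
    Measurable[N.sigmaOf S] fun ω n => (N.bsFade n ω, N.bsNormal n ω) := by
  refine @measurable_pi_lambda _ _ _ (N.sigmaOf S) _ _ fun n => ?_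
  exact (Elements.measurable_bsFade (h1 n)).prodMk (Elements.measurable_bsNormal (h2 n))

lemma disjoint_typeSources : Pairwise fun i k : Fin M => Disjoint (typeSources i) (typeSources k) := by
  intro i k hik
  rw [Set.disjoint_left]
  rintro j (rfl | ⟨n, rfl | rfl | rfl⟩) <;> simp [typeSources, hik]

lemma disjoint_bsSources_d2dSources : Disjoint (bsSources : Set (Source M)) d2dSources := by
  rw [Set.disjoint_left]
  rintro j (rfl | ⟨n, rfl | rfl⟩) <;> simp [d2dSources, typeSources]

/-- Interference of one D2D type. -/
noncomputable def interferenceType (P : Params M) (N : Elements M Ω) (i : Fin M) (ω : Ω) : ℝ≥0∞ :=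
  markedInterference P.α P.PD (fun _ => False) (fun n => N.d2dPos i n ω)
    fun n => (N.d2dFade i n ω, N.d2dActive i n ω && N.d2dAccess i n ω)

lemma interferenceD_eq (ω : Ω) :
    N.interferenceD P ω = ∑ i, interferenceType P N i ω := by
  unfold Elements.interferenceD interferenceType markedInterference
  simp

lemma measurable_interferenceType (i : Fin M) {S : Set (Source M)} (hS : typeSources i ⊆ S) :
    Measurable[N.sigmaOf S] (interferenceType P N i) := by
  have h1 : Measurable[N.sigmaOf S] fun ω n => N.d2dPos i n ω :=
    Elements.measurable_d2dPos (hS (.inl rfl))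
  refine @measurable_markedInterference _ _ Ω (N.sigmaOf S) _ _ _ (fun n => ?_) (fun n => ?_)
    fun n _ => ?_
  · exact MeasurableSet.const _
  · exact (measurable_pi_apply n).comp h1
  · have h2 : Measurable[N.sigmaOf S] (N.d2dFade i n) :=
      Elements.measurable_d2dFade (hS (.inr ⟨n, .inl rfl⟩))
    have h3 : Measurable[N.sigmaOf S] (N.d2dActive i n) :=
      Elements.measurable_d2dActive (hS (.inr ⟨n, .inr (.inl rfl)⟩))
    have h4 : Measurable[N.sigmaOf S] (N.d2dAccess i n) :=
      Elements.measurable_d2dAccess (hS (.inr ⟨n, .inr (.inr rfl)⟩))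
    have h5 : Measurable fun b : Bool × Bool => b.1 && b.2 := .of_discrete
    exact h2.prodMk (h5.comp (h3.prodMk h4))

lemma measurable_interferenceD {S : Set (Source M)} (hS : d2dSources ⊆ S) :
    Measurable[N.sigmaOf S] (N.interferenceD P) := by
  have : N.interferenceD P = fun ω => ∑ i, interferenceType P N i ω := funext interferenceD_eq
  rw [this]
  exact Finset.measurable_sum _ fun i _ =>
    measurable_interferenceType i ((subset_iUnion _ i).trans hS)

lemma interferenceB_eq (ω : Ω) :
    N.interferenceB P ω = markedInterference P.α P.PB (fun n => n = N.serving ω)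
      (fun n => N.bsPos n ω) fun n => (N.bsFade n ω, N.bsNormal n ω) := by
  unfold Elements.interferenceB markedInterference
  refine tsum_congr fun n => ?_
  congr!

lemma measurable_servingDist {S : Set (Source M)} (hS : .bsPos ∈ S) :
    Measurable[N.sigmaOf S] N.servingDist := by
  have h : N.servingDist = nearestDist ∘ fun ω n => N.bsPos n ω := rfl
  rw [h]
  exact measurable_nearestDist.comp (Elements.measurable_bsPos hS)

lemma measurable_interferenceB {S : Set (Source M)} (hS : bsSources ⊆ S) :
    Measurable[N.sigmaOf S] (N.interferenceB P) := by
  have h1 : Measurable[N.sigmaOf S] fun ω n => N.bsPos n ω :=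
    Elements.measurable_bsPos (hS (.inl rfl))
  have : N.interferenceB P = fun ω => markedInterference P.α P.PB (fun n => n = N.serving ω)
      (fun n => N.bsPos n ω) fun n => (N.bsFade n ω, N.bsNormal n ω) := funext interferenceB_eq
  rw [this]
  refine @measurable_markedInterference _ _ Ω (N.sigmaOf S) _ _ _ (fun n => ?_) (fun n => ?_)
    fun n _ => ?_
  · have h2 : Measurable[N.sigmaOf S] N.serving := measurable_nearestIndex.comp h1
    have : {ω | n = N.serving ω} = N.serving ⁻¹' {n} := by ext; simp [eq_comm]
    rw [this]
    exact h2 (measurableSet_singleton n)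
  · exact (measurable_pi_apply n).comp h1
  · have h2 : Measurable[N.sigmaOf S] (N.bsFade n) :=
      Elements.measurable_bsFade (hS (.inr ⟨n, .inl rfl⟩))
    have h3 : Measurable[N.sigmaOf S] (N.bsNormal n) :=
      Elements.measurable_bsNormal (hS (.inr ⟨n, .inr rfl⟩))
    exact h2.prodMk h3

end Generated

variable {M : ℕ} {P : Params M} {Ω : Type*} [mΩ : MeasurableSpace Ω] {μ : Measure Ω}
  {N : Elements M Ω}

lemma prob_active_access (hN : IsSharedNetwork P μ N) (i : Fin M) (n : ℕ) :
    μ.real {ω | (N.d2dActive i n ω && N.d2dAccess i n ω) = true} = P.pt i * P.pf i := by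
  have hd : Disjoint ({.d2dActive i n} : Set (Source M)) {.d2dAccess i n} := by simp
  have h := (Indep_iff _ _ _).1 (hN.indep_sigmaOf hd) _ _
    (Elements.measurable_d2dActive (mem_singleton _) (measurableSet_singleton true))
    (Elements.measurable_d2dAccess (mem_singleton _) (measurableSet_singleton true))
  rw [← hN.d2dActive_prob i n, ← hN.d2dAccess_prob i n, measureReal_def, measureReal_def,
    measureReal_def, ← ENNReal.toReal_mul]
  congr 1
  refine Eq.trans ?_ h
  congr 1
  ext ω
  simp

/-! ### Laplace transforms of the D2D and BS interference. -/

variable [IsProbabilityMeasure μ]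

/-- Laplace transform of the interference of one D2D type. -/
lemma lintegral_nexp_interferenceType (hN : IsSharedNetwork P μ N) (i : Fin M) {s : ℝ} (hs : 0 < s) :
    ∫⁻ ω, nexp (ENNReal.ofReal s * interferenceType P N i ω) ∂μ =
      ENNReal.ofReal (Real.exp (-(P.pt i * P.pf i * P.lamD i *
        (2 * Real.pi ^ 2 / P.α / Real.sin (2 * Real.pi / P.α)) * (s * P.PD) ^ (2 / P.α)))) := by
  have hα := P.two_lt_α
  have hsP : 0 < s * P.PD := mul_pos hs P.PD_pos
  have hq : P.pt i * P.pf i ∈ Icc (0 : ℝ) 1 :=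
    ⟨mul_nonneg (P.pt_mem i).1 (P.pf_mem i).1,
      mul_le_one₀ (P.pt_mem i).2 (P.pf_mem i).1 (P.pf_mem i).2⟩
  set m₂ : Set (Source M) :=
    {j | ∃ n, j = .d2dFade i n ∨ j = .d2dActive i n ∨ j = .d2dAccess i n} with hm₂
  have hd : Disjoint {.d2dPos i} m₂ := by simp [hm₂]
  have hW := Elements.measurable_d2dMarks (N := N) (S := m₂) (i := i) (fun n => ⟨n, .inl rfl⟩)
    (fun n => ⟨n, .inr (.inl rfl)⟩) fun n => ⟨n, .inr (.inr rfl)⟩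
  have hf : Measurable fun q : (ℕ → Plane) × (ℕ → ℝ × Bool) =>
      nexp (ENNReal.ofReal s * markedInterference P.α P.PD (fun _ => False) q.1 q.2) := by
    refine measurable_nexp.comp (Measurable.const_mul (measurable_markedInterference (fun n => ?_)
      (fun n => ?_) fun n _ => ?_) _)
    · exact MeasurableSet.const _
    · exact (measurable_pi_apply n).comp measurable_fst
    · exact (measurable_pi_apply n).comp measurable_snd
  -- Positions are frozen and marks averaged, which leaves a product of attenuations over the
  -- points.
  have h := lintegral_eq_lintegral_lintegral_of_indep (hN.sigmaOf_le _) (hN.sigmaOf_le _)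
    (hN.indep_sigmaOf hd) (Elements.measurable_d2dPos (mem_singleton _)) hW hf
  refine h.trans ?_
  have hin := fun x : ℕ → Plane => lintegral_nexp_markedInterference hN.sigma_le hN.indep
    (S := fun n => {.d2dActive i n, .d2dAccess i n}) (T := fun n => {.d2dFade i n})
    (by intro a b hab; simp [Set.disjoint_left, hab])
    (by intro n; simp) (fun n => Elements.measurable_d2dFade (mem_singleton _))
    (t := fun n ω => N.d2dActive i n ω && N.d2dAccess i n ω)
    (fun n => by
      have h3 : Measurable[N.sigmaOf {.d2dActive i n, .d2dAccess i n}] (N.d2dActive i n) :=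
        Elements.measurable_d2dActive (by simp)
      have h4 : Measurable[N.sigmaOf {.d2dActive i n, .d2dAccess i n}] (N.d2dAccess i n) :=
        Elements.measurable_d2dAccess (by simp)
      have h5 : Measurable fun b : Bool × Bool => b.1 && b.2 := .of_discrete
      exact h5.comp (h3.prodMk h4))
    (hN.d2dFade_law i) hs P.PD_pos hα (hN.prob_active_access i) (fun _ => False) x
  simp only [if_false] at hin
  simp_rw [hin]
  -- At radius 0 the event has full probability, so the survival formula reduces to the plain
  -- Laplace functional.
  have hL := (hN.d2d_ppp i).lintegral_nexp_tsum_nearestDist_gt (P.lamD_pos i)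
    (continuous_attn (p := P.pt i * P.pf i) hsP hα) (fun r _ => attn_nonneg hsP hq r)
    (fun r _ => attn_le_one hsP hq r) (integrableOn_mul_one_sub_attn hsP hα) le_rfl
  rw [← setLIntegral_univ]
  refine Eq.trans (setLIntegral_congr ?_) (hL.trans ?_)
  · filter_upwards [(hN.d2d_ppp i).ae_nearestDist_pos (P.lamD_pos i)] with ω hω
    exact propext ⟨fun _ => hω, fun _ => trivial⟩
  · rw [tailFun, integral_mul_one_sub_attn hsP hα]
    congr 3
    ring

/-- Laplace transform of the D2D interference. -/
lemma lintegral_nexp_interferenceD (hN : IsSharedNetwork P μ N) {s : ℝ} (hs : 0 < s) :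
    ∫⁻ ω, nexp (ENNReal.ofReal s * N.interferenceD P ω) ∂μ =
      ENNReal.ofReal (Real.exp (-(P.lamDTilde *
        (2 * Real.pi ^ 2 / P.α / Real.sin (2 * Real.pi / P.α)) * (s * P.PD) ^ (2 / P.α)))) := by
  simp_rw [interferenceD_eq, Finset.mul_sum, nexp_sum]
  rw [lintegral_prod_of_disjoint_groups hN.sigma_le hN.indep disjoint_typeSources
    (Y := fun i ω => nexp (ENNReal.ofReal s * interferenceType P N i ω))
    fun i => measurable_nexp.comp ((measurable_interferenceType i subset_rfl).const_mul _)]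
  simp_rw [fun i => hN.lintegral_nexp_interferenceType i hs]
  rw [← ENNReal.ofReal_prod_of_nonneg fun i _ => (Real.exp_pos _).le, ← Real.exp_sum]
  rw [Finset.sum_neg_distrib, ← Finset.sum_mul, ← Finset.sum_mul, Params.lamDTilde]

/-- Joint law of the distance to the serving BS and of the interference from the other BSs. -/
lemma lintegral_servingDist_mul_nexp (hN : IsSharedNetwork P μ N) (hρ : P.rhoS ∈ Icc (0 : ℝ) 1)
    {s : ℝ} (hs : 0 < s) {F : ℝ → ℝ≥0∞} (hF : Measurable F) :
    ∫⁻ ω, F (N.servingDist ω) * nexp (ENNReal.ofReal s * N.interferenceB P ω) ∂μ =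
      ∫⁻ t in Ioi 0, F t * ENNReal.ofReal (2 * Real.pi * P.lamB * t *
        tailFun P.lamB (attn P.rhoS (s * P.PB) P.α) t) := by
  have hα := P.two_lt_α
  have hsP : 0 < s * P.PB := mul_pos hs P.PB_pos
  set m₂ : Set (Source M) := {j | ∃ n, j = .bsFade n ∨ j = .bsNormal n} with hm₂
  have hd : Disjoint {.bsPos} m₂ := by simp [hm₂]
  have hW := Elements.measurable_bsMarks (N := N) (S := m₂) (fun n => ⟨n, .inl rfl⟩)
    fun n => ⟨n, .inr rfl⟩
  have hf : Measurable fun q : (ℕ → Plane) × (ℕ → ℝ × Bool) => F (nearestDist q.1) *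
      nexp (ENNReal.ofReal s *
        markedInterference P.α P.PB (fun n => n = nearestIndex q.1) q.1 q.2) := by
    refine (hF.comp (measurable_nearestDist.comp measurable_fst)).mul
      (measurable_nexp.comp (Measurable.const_mul (measurable_markedInterference (fun n => ?_)
      (fun n => ?_) fun n _ => ?_) _))
    · exact measurableSet_eq_fun measurable_const (measurable_nearestIndex.comp measurable_fst)
    · exact (measurable_pi_apply n).comp measurable_fst
    · exact (measurable_pi_apply n).comp measurable_snd
  -- The serving index is a function of the positions, so freezing them also fixes which point is
  -- excluded.
  have h := lintegral_eq_lintegral_lintegral_of_indep (hN.sigmaOf_le _) (hN.sigmaOf_le _)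
    (hN.indep_sigmaOf hd) (Elements.measurable_bsPos (mem_singleton _)) hW hf
  simp_rw [interferenceB_eq]
  refine h.trans ?_
  have hin := fun x : ℕ → Plane => lintegral_nexp_markedInterference hN.sigma_le hN.indep
    (S := fun n => {.bsNormal n}) (T := fun n => {.bsFade n})
    (by intro a b hab; simp [hab.symm]) (by intro n; simp)
    (fun n => Elements.measurable_bsFade (mem_singleton _))
    (fun n => Elements.measurable_bsNormal (mem_singleton _))
    hN.bsFade_law hs P.PB_pos hα hN.bsNormal_prob (fun n => n = nearestIndex x) x
  have hmul : ∀ ω, ∫⁻ ω', F (nearestDist fun n => N.bsPos n ω) * nexp (ENNReal.ofReal s *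
      markedInterference P.α P.PB (fun n => n = nearestIndex fun n => N.bsPos n ω)
        (fun n => N.bsPos n ω) fun n => (N.bsFade n ω', N.bsNormal n ω')) ∂μ =
      F (nearestDist fun n => N.bsPos n ω) *
        nexp (∑' n, if n = nearestIndex (fun n => N.bsPos n ω) then 0
          else nlog (ENNReal.ofReal (attn P.rhoS (s * P.PB) P.α ‖N.bsPos n ω‖))) := by
    intro ω
    rw [← hin, lintegral_const_mul]
    have h2 := hW.mono (hN.sigmaOf_le _) le_rfl
    refine measurable_nexp.comp (Measurable.const_mul (measurable_markedInterference (fun n => ?_)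
      (fun n => ?_) fun n _ => ?_) _)
    · exact MeasurableSet.const _
    · exact measurable_const
    · exact (measurable_pi_apply n).comp h2
  simp only
  simp_rw [hmul]
  exact hN.bs_ppp.lintegral_nearestDist_mul_nexp P.lamB_pos (continuous_attn hsP hα)
    (fun r _ => attn_nonneg hsP hρ r) (fun r hr => attn_pos hsP hρ hr)
    (fun r _ => attn_le_one hsP hρ r) (integrableOn_mul_one_sub_attn hsP hα) hF

end IsSharedNetwork

/-! ### From joint laws to conditional laws. -/

/-- For s > 0 the convention e^{-∞} = 0 agrees with s · ∞ = ∞. At s = 0 the two integrands differ at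
∞, since 0 · ∞ = 0. -/
lemma laplace_of_pos (ν : Measure ℝ≥0∞) {s : ℝ} (hs : 0 < s) :
    laplace ν s = (∫⁻ x, nexp (ENNReal.ofReal s * x) ∂ν).toReal := by
  have hs' : ENNReal.ofReal s ≠ 0 := by simpa using hs
  rw [laplace, ← integral_toReal]
  · refine integral_congr_ae (ae_of_all _ fun x => ?_)
    simp only
    split_ifs with hx
    · simp [hx, ENNReal.mul_top, hs]
    · rw [nexp_of_ne_top (ENNReal.mul_ne_top ENNReal.ofReal_ne_top hx), ENNReal.toReal_mul,
        ENNReal.toReal_ofReal hs.le, ENNReal.toReal_ofReal (Real.exp_pos _).le]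
  · exact (measurable_nexp.comp (measurable_id.const_mul _)).aemeasurable
  · exact ae_of_all _ fun x => (nexp_ne_top _).lt_top

lemma tendsto_lintegral_nexp_mul {α : Type*} [MeasurableSpace α] (ν : Measure α) [IsFiniteMeasure ν]
    {Y : α → ℝ≥0∞} (hY : Measurable Y) {u : ℕ → ℝ} {s : ℝ} (hs : 0 < s)
    (hu : Tendsto u atTop (𝓝 s)) :
    Tendsto (fun n => ∫⁻ x, nexp (ENNReal.ofReal (u n) * Y x) ∂ν) atTop
      (𝓝 (∫⁻ x, nexp (ENNReal.ofReal s * Y x) ∂ν)) := by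
  refine tendsto_lintegral_of_dominated_convergence (fun _ => 1) (fun n => ?_) (fun n => ?_)
    (by simp) (ae_of_all _ fun x => (continuous_nexp.tendsto _).comp ?_)
  · exact measurable_nexp.comp (hY.const_mul _)
  · exact ae_of_all _ fun x => nexp_le_one _
  · exact ENNReal.Tendsto.mul_const (ENNReal.tendsto_ofReal hu) (.inl (by simpa using hs))

lemma Params.rhoS_mem {M : ℕ} (P : Params M) : P.rhoS ∈ Icc (0 : ℝ) 1 := by
  refine ⟨le_min (div_nonneg (add_nonneg (mul_nonneg P.bC_nonneg P.lamU_pos.le)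
    (Finset.sum_nonneg fun i _ => mul_nonneg (mul_nonneg (P.bD_nonneg i) ?_) (P.lamD_pos i).le))
    (mul_nonneg P.lamB_pos.le (Nat.cast_nonneg _))) zero_le_one, min_le_right _ _⟩
  linarith [(P.pt_mem i).2]

lemma nearestDensity_pos {lam : ℝ} (hlam : 0 < lam) {r : ℝ} (hr : 0 < r) :
    0 < nearestDensity lam r := by
  have := Real.pi_pos
  unfold nearestDensity
  positivity

lemma measurable_nearestDensity (lam : ℝ) : Measurable (nearestDensity lam) := by
  unfold nearestDensity
  fun_prop

namespace IsSharedNetwork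

variable {M : ℕ} {P : Params M} {Ω : Type*} [mΩ : MeasurableSpace Ω] {μ : Measure Ω}
  {N : Elements M Ω}

lemma servingDist_measurable (hN : IsSharedNetwork P μ N) : Measurable N.servingDist :=
  (measurable_servingDist (mem_univ _)).mono (hN.sigmaOf_le univ) le_rfl

lemma interferenceB_measurable (hN : IsSharedNetwork P μ N) : Measurable (N.interferenceB P) :=
  (measurable_interferenceB (subset_univ _)).mono (hN.sigmaOf_le univ) le_rfl

lemma interferenceD_measurable (hN : IsSharedNetwork P μ N) : Measurable (N.interferenceD P) :=
  (measurable_interferenceD (subset_univ _)).mono (hN.sigmaOf_le univ) le_rfl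

variable [IsProbabilityMeasure μ]

lemma map_servingDist (hN : IsSharedNetwork P μ N) :
    μ.map N.servingDist = (volume.restrict (Ioi (0 : ℝ))).withDensity
      fun r => ENNReal.ofReal (nearestDensity P.lamB r) :=
  hN.bs_ppp.map_nearestDist P.lamB_pos

lemma lintegral_map_servingDist (hN : IsSharedNetwork P μ N) {F : ℝ → ℝ≥0∞}
    (hF : AEMeasurable F (volume.restrict (Ioi (0 : ℝ)))) :
    ∫⁻ r, F r ∂(μ.map N.servingDist) =
      ∫⁻ r in Ioi (0 : ℝ), F r * ENNReal.ofReal (nearestDensity P.lamB r) := by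
  have hm := (measurable_nearestDensity P.lamB).ennreal_ofReal
  rw [hN.map_servingDist, lintegral_withDensity_eq_lintegral_mul₀ hm.aemeasurable
    hF]
  exact lintegral_congr fun r => mul_comm _ _

/-- The density of the serving distance is positive on (0, ∞), so null sets for its law are Lebesgue
null there. -/
lemma ae_of_ae_map_servingDist (hN : IsSharedNetwork P μ N) {p : ℝ → Prop}
    (h : ∀ᵐ r ∂(μ.map N.servingDist), p r) : ∀ᵐ r ∂(volume.restrict (Ioi (0 : ℝ))), p r := by
  rw [hN.map_servingDist, ae_withDensity_iff (measurable_nearestDensity P.lamB).ennreal_ofReal] at h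
  filter_upwards [h, ae_restrict_mem measurableSet_Ioi] with r hr h0
  exact hr (by simpa using nearestDensity_pos P.lamB_pos h0)

/-- Laplace transform of the conditional law of the BS interference, for a fixed argument. -/
lemma ae_lintegral_nexp_condDistrib (hN : IsSharedNetwork P μ N) {s : ℝ} (hs : 0 < s) :
    ∀ᵐ r ∂(volume.restrict (Ioi (0 : ℝ))),
      ∫⁻ y, nexp (ENNReal.ofReal s * y) ∂(condDistrib (N.interferenceB P) N.servingDist μ r) =
        ENNReal.ofReal (tailFun P.lamB (attn P.rhoS (s * P.PB) P.α) r *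
          Real.exp (P.lamB * Real.pi * r ^ 2)) := by
  have hα := P.two_lt_α
  have hsP : 0 < s * P.PB := mul_pos hs P.PB_pos
  have hR := hN.servingDist_measurable
  have hB := hN.interferenceB_measurable
  have hprob : IsProbabilityMeasure (μ.map N.servingDist) :=
    Measure.isProbabilityMeasure_map hR.aemeasurable
  have hK : Measurable fun r => ∫⁻ y, nexp (ENNReal.ofReal s * y)
      ∂(condDistrib (N.interferenceB P) N.servingDist μ r) :=
    (measurable_nexp.comp (measurable_id.const_mul _)).lintegral_kernel
  have hQ : AEMeasurable (fun r => ENNReal.ofReal (tailFun P.lamB (attn P.rhoS (s * P.PB) P.α) r *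
      Real.exp (P.lamB * Real.pi * r ^ 2))) (volume.restrict (Ioi (0 : ℝ))) := by
    have := aemeasurable_tailFun (lam := P.lamB) (continuous_attn (p := P.rhoS) hsP hα)
      (integrableOn_mul_one_sub_attn hsP hα)
    fun_prop
  have hac : μ.map N.servingDist ≪ volume.restrict (Ioi (0 : ℝ)) := by
    rw [hN.map_servingDist]
    exact withDensity_absolutelyContinuous _ _
  -- Both sides are tested on Borel sets A: the left by disintegration, the right by the joint law
  -- with F the indicator of A. The factor exp(λπr²) comes from dividing by the density of the
  -- serving distance.
  refine hN.ae_of_ae_map_servingDist (ae_eq_of_forall_setLIntegral_eq_of_sigmaFinite₀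
    hK.aemeasurable (hQ.mono_ac hac) fun A hA _ => ?_)
  have h := hN.lintegral_servingDist_mul_nexp P.rhoS_mem hs
    (F := A.indicator 1) (measurable_one.indicator hA)
  have hfm : Measurable fun q : ℝ × ℝ≥0∞ => A.indicator (1 : ℝ → ℝ≥0∞) q.1 *
      nexp (ENNReal.ofReal s * q.2) :=
    ((measurable_one.indicator hA).comp measurable_fst).mul
      (measurable_nexp.comp (measurable_snd.const_mul _))
  have h2 := lintegral_map hfm (hR.prodMk hB) (μ := μ)
  rw [← compProd_map_condDistrib hB.aemeasurable, Measure.lintegral_compProd hfm] at h2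
  have h3 : ∀ r, ∫⁻ y, A.indicator (1 : ℝ → ℝ≥0∞) r * nexp (ENNReal.ofReal s * y)
      ∂(condDistrib (N.interferenceB P) N.servingDist μ r) =
      A.indicator (fun r => ∫⁻ y, nexp (ENNReal.ofReal s * y)
        ∂(condDistrib (N.interferenceB P) N.servingDist μ r)) r := by
    intro r
    by_cases hr : r ∈ A <;> simp [hr]
  simp only [h3] at h2
  rw [lintegral_indicator hA] at h2
  rw [h2]
  refine h.trans ?_
  rw [← lintegral_indicator hA, hN.lintegral_map_servingDist (hQ.indicator hA)]
  refine setLIntegral_congr_fun measurableSet_Ioi fun r hr => ?_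
  have hr0 : 0 < r := hr
  have hT : 0 ≤ tailFun P.lamB (attn P.rhoS (s * P.PB) P.α) r := (Real.exp_pos _).le
  by_cases hrA : r ∈ A
  · simp only [indicator_of_mem hrA, Pi.one_apply, one_mul]
    rw [← ENNReal.ofReal_mul (by positivity)]
    congr 1
    rw [nearestDensity, Real.exp_neg]
    field_simp
  · simp [hrA]

/-- Laplace transform of the conditional law of the BS interference. -/
lemma ae_forall_lintegral_nexp_condDistrib (hN : IsSharedNetwork P μ N) :
    ∀ᵐ r ∂(volume.restrict (Ioi (0 : ℝ))), ∀ s : ℝ, 0 < s →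
      ∫⁻ y, nexp (ENNReal.ofReal s * y) ∂(condDistrib (N.interferenceB P) N.servingDist μ r) =
        ENNReal.ofReal (tailFun P.lamB (attn P.rhoS (s * P.PB) P.α) r *
          Real.exp (P.lamB * Real.pi * r ^ 2)) := by
  -- Countably many null sets are discarded, one for each positive rational; both sides are then
  -- continued to real s along rationals increasing to s.
  have h : ∀ᵐ r ∂(volume.restrict (Ioi (0 : ℝ))), ∀ q : ℚ, 0 < (q : ℝ) →
      ∫⁻ y, nexp (ENNReal.ofReal q * y) ∂(condDistrib (N.interferenceB P) N.servingDist μ r) =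
        ENNReal.ofReal (tailFun P.lamB (attn P.rhoS (q * P.PB) P.α) r *
          Real.exp (P.lamB * Real.pi * r ^ 2)) := by
    rw [ae_all_iff]
    intro q
    by_cases hq : 0 < (q : ℝ)
    · filter_upwards [hN.ae_lintegral_nexp_condDistrib hq] with r hr _ using hr
    · exact ae_of_all _ fun r h => absurd h hq
  filter_upwards [h, ae_restrict_mem measurableSet_Ioi] with r hr hr0 s hs
  obtain ⟨u, -, hu, hlim⟩ :=
    (Rat.denseRange_cast (𝕜 := ℝ)).exists_seq_strictMono_tendsto_of_lt Rat.cast_strictMono.monotone hs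
  have hu0 : ∀ n, 0 < (u n : ℝ) := fun n => (hu n).1
  have h1 := tendsto_lintegral_nexp_mul
    (condDistrib (N.interferenceB P) N.servingDist μ r) measurable_id hs hlim
  refine tendsto_nhds_unique h1 ?_
  have h2 := tendsto_tailFun_attn (p := P.rhoS) (lam := P.lamB) P.two_lt_α (le_of_lt hr0)
    (u := fun n => (u n : ℝ) * P.PB) (mul_pos hs P.PB_pos) (fun n => mul_pos (hu0 n) P.PB_pos)
    (hlim.mul_const _) (fun n => mul_le_mul_of_nonneg_right (hu n).2.le P.PB_pos.le)
  refine (ENNReal.tendsto_ofReal (h2.mul_const _)).congr fun n => (hr (u n) (hu0 n)).symm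

/-- The exceptional set does not depend on s, so s may depend on r. With s = βr^α/P_B the parameter
c = sP_B is βr^α, the case in which the tail integral scales. -/
lemma ae_lintegral_nexp_condDistrib_eq (hN : IsSharedNetwork P μ N) {β : ℝ} (hβ : 0 < β) :
    ∀ᵐ r ∂(volume.restrict (Ioi (0 : ℝ))),
      ∫⁻ y, nexp (ENNReal.ofReal (β * r ^ P.α / P.PB) * y)
        ∂(condDistrib (N.interferenceB P) N.servingDist μ r) =
        ENNReal.ofReal (Real.exp (-(2 * Real.pi * P.rhoS * P.lamB * r ^ 2 * H1 β P.α))) := by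
  filter_upwards [hN.ae_forall_lintegral_nexp_condDistrib, ae_restrict_mem measurableSet_Ioi]
    with r hr hr0
  have hr0 : 0 < r := hr0
  have hPB := P.PB_pos
  rw [hr _ (by positivity), div_mul_cancel₀ _ hPB.ne', tailFun_attn hβ hr0, Real.exp_neg]
  congr 1
  field_simp

lemma laplaceD_of_pos (hN : IsSharedNetwork P μ N) {s : ℝ} (hs : 0 < s) :
    laplaceD P μ N s = Real.exp (-(P.lamDTilde *
      (2 * Real.pi ^ 2 / P.α / Real.sin (2 * Real.pi / P.α)) * (s * P.PD) ^ (2 / P.α))) := by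
  have hm : Measurable fun x => nexp (ENNReal.ofReal s * x) :=
    measurable_nexp.comp (measurable_id.const_mul _)
  rw [laplaceD, laplace_of_pos _ hs, lintegral_map hm hN.interferenceD_measurable,
    hN.lintegral_nexp_interferenceD hs, ENNReal.toReal_ofReal (Real.exp_pos _).le]

/-- As s decreases to 0, e^{-sI} tends to the indicator of I < ∞, while the explicit transform tends
to 1. -/
lemma ae_interferenceD_ne_top (hN : IsSharedNetwork P μ N) : ∀ᵐ ω ∂μ, N.interferenceD P ω ≠ ∞ := by
  have hα := P.two_lt_α
  have hm : MeasurableSet {ω | N.interferenceD P ω ≠ ∞} :=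
    (hN.interferenceD_measurable (measurableSet_singleton ∞)).compl
  refine (mem_ae_iff_prob_eq_one hm).2 ?_
  have hu0 : ∀ n : ℕ, (0 : ℝ) < 1 / ((n : ℝ) + 1) := fun n => by positivity
  have hu := tendsto_one_div_add_atTop_nhds_zero_nat (𝕜 := ℝ)
  have h1 : Tendsto (fun n : ℕ => ∫⁻ ω, nexp (ENNReal.ofReal (1 / ((n : ℝ) + 1)) *
      N.interferenceD P ω) ∂μ) atTop
      (𝓝 (∫⁻ ω, {ω | N.interferenceD P ω ≠ ∞}.indicator 1 ω ∂μ)) := by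
    refine tendsto_lintegral_of_dominated_convergence (fun _ => 1) (fun n => ?_) (fun n => ?_)
      (by simp) (ae_of_all _ fun ω => ?_)
    · exact measurable_nexp.comp (hN.interferenceD_measurable.const_mul _)
    · exact ae_of_all _ fun ω => nexp_le_one _
    · by_cases hω : N.interferenceD P ω = ∞
      · refine tendsto_const_nhds.congr fun n => ?_
        rw [hω, ENNReal.mul_top (by simpa using hu0 n)]
        simp [hω]
      · have h2 := ENNReal.Tendsto.mul_const (b := N.interferenceD P ω)
          (ENNReal.tendsto_ofReal hu) (.inr hω)
        have h3 := (continuous_nexp.tendsto _).comp h2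
        simpa [hω, Function.comp_def] using h3
  rw [lintegral_indicator_one hm] at h1
  refine tendsto_nhds_unique h1 ?_
  simp_rw [fun n => hN.lintegral_nexp_interferenceD (hu0 n)]
  have h4 : Tendsto (fun s : ℝ => ENNReal.ofReal (Real.exp (-(P.lamDTilde *
      (2 * Real.pi ^ 2 / P.α / Real.sin (2 * Real.pi / P.α)) * (s * P.PD) ^ (2 / P.α))))) (𝓝 0)
      (𝓝 1) := by
    have hexp : 0 < 2 / P.α := by have : 0 < P.α := by linarith
                                  positivity
    have hc : Continuous fun s : ℝ => ENNReal.ofReal (Real.exp (-(P.lamDTilde *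
        (2 * Real.pi ^ 2 / P.α / Real.sin (2 * Real.pi / P.α)) * (s * P.PD) ^ (2 / P.α)))) := by
      have : Continuous fun s : ℝ => (s * P.PD) ^ (2 / P.α) :=
        (continuous_id.mul continuous_const).rpow_const fun _ => .inr hexp.le
      exact ENNReal.continuous_ofReal.comp (by fun_prop)
    have := hc.tendsto 0
    simpa [Real.zero_rpow hexp.ne'] using this
  exact h4.comp hu

/-- Laplace transform of the law of the D2D interference. -/
lemma laplaceD_eq (hN : IsSharedNetwork P μ N) {s : ℝ} (hs : 0 ≤ s) :
    laplaceD P μ N s = Real.exp (-(P.lamDTilde *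
      (2 * Real.pi ^ 2 / P.α / Real.sin (2 * Real.pi / P.α)) * (s * P.PD) ^ (2 / P.α))) := by
  rcases hs.eq_or_lt with rfl | hs
  · have hα := P.two_lt_α
    have hexp : 2 / P.α ≠ 0 := by
      have : 0 < P.α := by linarith
      positivity
    have hm : MeasurableSet {x : ℝ≥0∞ | x ≠ ∞} := (measurableSet_singleton ∞).compl
    -- At s = 0 the transform is the probability that the interference is finite, so the formula
    -- needs this to be 1.
    have h1 : ∀ᵐ x ∂(μ.map (N.interferenceD P)), x ≠ ∞ :=
      (ae_map_iff hN.interferenceD_measurable.aemeasurable hm).2 hN.ae_interferenceD_ne_top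
    have h2 : IsProbabilityMeasure (μ.map (N.interferenceD P)) :=
      Measure.isProbabilityMeasure_map hN.interferenceD_measurable.aemeasurable
    rw [laplaceD, laplace, integral_congr_ae (g := fun _ => (1 : ℝ))]
    · simp [Real.zero_rpow hexp]
    · filter_upwards [h1] with x hx
      simp [hx]
  · exact hN.laplaceD_of_pos hs

end IsSharedNetwork

/-! ### The coverage probability. -/

/-- Probability that the received power with Rayleigh fading exceeds `β` times `y`. -/
lemma measure_lt_receivedPower_div {Ω : Type*} [MeasurableSpace Ω] {μ : Measure Ω} {h : Ω → ℝ}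
    (hl : HasLaw h (expMeasure 1) μ) {α p β : ℝ} (hp : 0 < p) (hβ : 0 < β) {x : Plane}
    (hx : 0 < ‖x‖) (y : ℝ≥0∞) :
    μ {ω | ENNReal.ofReal β < receivedPower α p (h ω) x / y} =
      nexp (ENNReal.ofReal (β * ‖x‖ ^ α / p) * y) := by
  rw [← expMeasure_tail]
  have hm : MeasurableSet {t : ℝ | ENNReal.ofReal (β * ‖x‖ ^ α / p) * y < ENNReal.ofReal t} :=
    measurableSet_lt measurable_const ENNReal.measurable_ofReal
  rw [← hl.map_eq, Measure.map_apply_of_aemeasurable hl.aemeasurable hm]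
  have hpos : ∀ᵐ ω ∂μ, 0 < h ω := by
    refine (ae_map_iff hl.aemeasurable measurableSet_Ioi).1 ?_
    rw [hl.map_eq]
    exact expMeasure_pos
  refine measure_congr ?_
  filter_upwards [hpos] with ω hω
  refine propext (Iff.trans (ENNReal.lt_div_iff_mul_lt (.inr ENNReal.ofReal_ne_top)
    (.inr (by simpa using hβ))) ?_)
  have hk : 0 < ‖x‖ ^ α / p := by positivity
  have hk0 : ENNReal.ofReal (‖x‖ ^ α / p) ≠ 0 := by simpa using hk
  have e1 : ENNReal.ofReal (β * ‖x‖ ^ α / p) * y =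
      ENNReal.ofReal (‖x‖ ^ α / p) * (ENNReal.ofReal β * y) := by
    rw [mul_div_assoc, ENNReal.ofReal_mul hβ.le]
    ring
  have e2 : ENNReal.ofReal (h ω) = ENNReal.ofReal (‖x‖ ^ α / p) * receivedPower α p (h ω) x := by
    rw [receivedPower, ← ofReal_norm, ENNReal.ofReal_rpow_of_pos hx,
      ← ENNReal.ofReal_mul (by positivity), ← ENNReal.ofReal_mul (by positivity)]
    congr 1
    rw [Real.rpow_neg hx.le]
    field_simp
  change _ ↔ ENNReal.ofReal (β * ‖x‖ ^ α / p) * y < ENNReal.ofReal (h ω)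
  rw [e1, e2, ENNReal.mul_lt_mul_iff_right hk0 ENNReal.ofReal_ne_top]

namespace IsSharedNetwork

/-- The SINR as a function of the positions and the marks of the BSs and of the D2D
interference. -/
noncomputable def sinrOf {M : ℕ} (P : Params M) (x : ℕ → Plane) (w : ℕ → ℝ × Bool) (d : ℝ≥0∞) :
    ℝ≥0∞ :=
  receivedPower P.α P.PB (w (nearestIndex x)).1 (x (nearestIndex x)) /
    (d + markedInterference P.α P.PB (fun n => n = nearestIndex x) x w + ENNReal.ofReal P.noise)

lemma measurable_markedInterference_nearest {M : ℕ} (P : Params M) :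
    Measurable fun q : (ℕ → Plane) × ((ℕ → ℝ × Bool) × ℝ≥0∞) =>
      markedInterference P.α P.PB (fun n => n = nearestIndex q.1) q.1 q.2.1 := by
  refine measurable_markedInterference (fun n => ?_) (fun n => ?_) fun n _ => ?_
  · exact measurableSet_eq_fun measurable_const (measurable_nearestIndex.comp measurable_fst)
  · exact (measurable_pi_apply n).comp measurable_fst
  · exact (measurable_pi_apply n).comp (measurable_fst.comp measurable_snd)

lemma measurable_sinrOf {M : ℕ} (P : Params M) :
    Measurable fun q : (ℕ → Plane) × ((ℕ → ℝ × Bool) × ℝ≥0∞) => sinrOf P q.1 q.2.1 q.2.2 := by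
  have he : Measurable fun p : ((ℕ → Plane) × (ℕ → ℝ × Bool)) × ℕ =>
      receivedPower P.α P.PB (p.1.2 p.2).1 (p.1.1 p.2) :=
    measurable_from_prod_countable_left fun n => (measurable_receivedPower P.α P.PB).comp
      (((measurable_pi_apply n).comp measurable_snd).fst.prodMk
        ((measurable_pi_apply n).comp measurable_fst))
  have h1 : Measurable fun q : (ℕ → Plane) × ((ℕ → ℝ × Bool) × ℝ≥0∞) =>
      (((q.1, q.2.1), nearestIndex q.1) : ((ℕ → Plane) × (ℕ → ℝ × Bool)) × ℕ) :=
    (measurable_fst.prodMk measurable_snd.fst).prodMk (measurable_nearestIndex.comp measurable_fst)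
  have h2 := he.comp h1
  have h3 := (measurable_snd.snd.add (measurable_markedInterference_nearest P)).add
    (measurable_const (a := ENNReal.ofReal P.noise))
  exact h2.div h3

lemma measurable_markedInterference_of_ne {M : ℕ} {P : Params M} {Ω : Type*} {N : Elements M Ω}
    {S : Set (Source M)} (x : ℕ → Plane) (k : ℕ) (h1 : ∀ n, n ≠ k → .bsFade n ∈ S)
    (h2 : ∀ n, .bsNormal n ∈ S) : Measurable[N.sigmaOf S] fun ω =>
      markedInterference P.α P.PB (fun n => n = k) x (fun n => (N.bsFade n ω, N.bsNormal n ω)) := by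
  refine @measurable_markedInterference P.α P.PB Ω (N.sigmaOf S) (fun _ n => n = k)
    (fun _ => x) (fun ω n => (N.bsFade n ω, N.bsNormal n ω)) (fun n => ?_) (fun n => ?_)
    fun n hn => ?_
  · exact MeasurableSet.const _
  · exact measurable_const
  · exact (Elements.measurable_bsFade (h1 n fun h => hn fun _ => h)).prodMk
      (Elements.measurable_bsNormal (h2 n))

variable {M : ℕ} {P : Params M} {Ω : Type*} [mΩ : MeasurableSpace Ω] {μ : Measure Ω}
  {N : Elements M Ω} [IsProbabilityMeasure μ]

/-- The coverage probability for given positions of the BSs. -/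
lemma measure_lt_sinrOf (hN : IsSharedNetwork P μ N) {β : ℝ} (hβ : 0 < β) (x : ℕ → Plane)
    (hx : 0 < nearestDist x) :
    μ {ω | ENNReal.ofReal β <
      sinrOf P x (fun n => (N.bsFade n ω, N.bsNormal n ω)) (N.interferenceD P ω)} =
    ∫⁻ ω, nexp (ENNReal.ofReal (β * nearestDist x ^ P.α / P.PB) * (N.interferenceD P ω +
      markedInterference P.α P.PB (fun n => n = nearestIndex x) x
        (fun n => (N.bsFade n ω, N.bsNormal n ω)) + ENNReal.ofReal P.noise)) ∂μ := by
  set k := nearestIndex x with hk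
  set Y : Ω → ℝ≥0∞ := fun ω => N.interferenceD P ω +
      markedInterference P.α P.PB (fun n => n = k) x
        (fun n => (N.bsFade n ω, N.bsNormal n ω)) + ENNReal.ofReal P.noise with hY
  -- For fixed positions the denominator uses every source except the fading of BS k, which only
  -- enters the signal; the exponential tail can thus be applied with the denominator frozen.
  have hd : Disjoint ({.bsFade k}ᶜ : Set (Source M)) {.bsFade k} := disjoint_compl_left
  have hYm : Measurable[N.sigmaOf {.bsFade k}ᶜ] Y := by
    have h1 : Measurable[N.sigmaOf {.bsFade k}ᶜ] (N.interferenceD P) := by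
      refine measurable_interferenceD fun j hj => ?_
      obtain ⟨i, hi⟩ := mem_iUnion.1 hj
      rintro rfl
      simp [typeSources] at hi
    have h2 := measurable_markedInterference_of_ne (P := P) (N := N) (S := {.bsFade k}ᶜ) x k
      (fun n hn => by simpa using hn) fun n => by simp
    exact (h1.add h2).add_const _
  have hh : Measurable[N.sigmaOf {.bsFade k}] (N.bsFade k) :=
    Elements.measurable_bsFade (mem_singleton _)
  set A : Set (ℝ≥0∞ × ℝ) :=
    {q | ENNReal.ofReal β < receivedPower P.α P.PB q.2 (x k) / q.1} with hA
  have hAm : MeasurableSet A := by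
    refine measurableSet_lt measurable_const (Measurable.div ?_ measurable_fst)
    exact (measurable_receivedPower P.α P.PB).comp (measurable_snd.prodMk measurable_const)
  have h := lintegral_eq_lintegral_lintegral_of_indep (hN.sigmaOf_le _) (hN.sigmaOf_le _)
    (hN.indep_sigmaOf hd) hYm hh (f := A.indicator 1) (measurable_one.indicator hAm)
  have hYm' : Measurable Y := hYm.mono (hN.sigmaOf_le _) le_rfl
  have hpair : Measurable fun ω => (Y ω, N.bsFade k ω) := hYm'.prodMk (hN.bsFade_measurable k)
  have h1 : ∫⁻ ω, A.indicator (1 : ℝ≥0∞ × ℝ → ℝ≥0∞) (Y ω, N.bsFade k ω) ∂μ =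
      μ ((fun ω => (Y ω, N.bsFade k ω)) ⁻¹' A) := by
    rw [← lintegral_indicator_one (hpair hAm)]
    rfl
  have h2 : ∀ y, ∫⁻ ω, A.indicator (1 : ℝ≥0∞ × ℝ → ℝ≥0∞) (y, N.bsFade k ω) ∂μ =
      nexp (ENNReal.ofReal (β * nearestDist x ^ P.α / P.PB) * y) := by
    intro y
    have := measure_lt_receivedPower_div (α := P.α) (hN.bsFade_law k) P.PB_pos hβ (x := x k) hx y
    have hm : MeasurableSet ((fun ω => (y, N.bsFade k ω)) ⁻¹' A) :=
      (measurable_const.prodMk (hN.bsFade_measurable k)) hAm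
    refine Eq.trans ?_ this
    change _ = μ ((fun ω => (y, N.bsFade k ω)) ⁻¹' A)
    rw [← lintegral_indicator_one hm]
    rfl
  rw [h1] at h
  simp_rw [h2] at h
  exact h

/-- The coverage probability as a Laplace transform. -/
lemma measure_lt_sinr (hN : IsSharedNetwork P μ N) {β : ℝ} (hβ : 0 < β) :
    μ {ω | ENNReal.ofReal β < N.sinr P ω} =
      ∫⁻ ω, nexp (ENNReal.ofReal (β * N.servingDist ω ^ P.α / P.PB) *
        (N.interferenceD P ω + N.interferenceB P ω + ENNReal.ofReal P.noise)) ∂μ := by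
  -- The serving fading has a random index. Freezing the positions makes the index deterministic;
  -- the positions are averaged again afterwards through `e2`.
  have hd : Disjoint ({.bsPos} : Set (Source M)) {.bsPos}ᶜ := disjoint_compl_right
  set X : Ω → ℕ → Plane := fun ω n => N.bsPos n ω with hXdef
  set W : Ω → (ℕ → ℝ × Bool) × ℝ≥0∞ :=
    fun ω => (fun n => (N.bsFade n ω, N.bsNormal n ω), N.interferenceD P ω) with hWdef
  have hX : Measurable[N.sigmaOf {.bsPos}] X := Elements.measurable_bsPos (mem_singleton _)
  have hW : Measurable[N.sigmaOf {.bsPos}ᶜ] W := by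
    refine Measurable.prodMk (Elements.measurable_bsMarks (by simp) (by simp))
      (measurable_interferenceD fun j hj => ?_)
    obtain ⟨i, hi⟩ := mem_iUnion.1 hj
    rintro rfl
    simp [typeSources] at hi
  set A : Set ((ℕ → Plane) × ((ℕ → ℝ × Bool) × ℝ≥0∞)) :=
    {q | ENNReal.ofReal β < sinrOf P q.1 q.2.1 q.2.2} with hA
  have hAm : MeasurableSet A := measurableSet_lt measurable_const (measurable_sinrOf P)
  set f : (ℕ → Plane) × ((ℕ → ℝ × Bool) × ℝ≥0∞) → ℝ≥0∞ := fun q =>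
    nexp (ENNReal.ofReal (β * nearestDist q.1 ^ P.α / P.PB) * (q.2.2 +
      markedInterference P.α P.PB (fun n => n = nearestIndex q.1) q.1 q.2.1 +
        ENNReal.ofReal P.noise)) with hf
  have hfm : Measurable f := by
    have h1 := measurable_markedInterference_nearest P
    have h2 : Measurable fun q : (ℕ → Plane) × ((ℕ → ℝ × Bool) × ℝ≥0∞) => nearestDist q.1 :=
      measurable_nearestDist.comp measurable_fst
    refine measurable_nexp.comp (Measurable.mul ?_ ((measurable_snd.snd.add h1).add_const _))
    fun_prop
  have e1 := lintegral_eq_lintegral_lintegral_of_indep (hN.sigmaOf_le _) (hN.sigmaOf_le _)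
    (hN.indep_sigmaOf hd) hX hW (f := A.indicator 1) (measurable_one.indicator hAm)
  have e2 := lintegral_eq_lintegral_lintegral_of_indep (hN.sigmaOf_le _) (hN.sigmaOf_le _)
    (hN.indep_sigmaOf hd) hX hW hfm
  have hX' : Measurable X := hX.mono (hN.sigmaOf_le _) le_rfl
  have hW' : Measurable W := hW.mono (hN.sigmaOf_le _) le_rfl
  have e3 : ∫⁻ ω, A.indicator (1 : (ℕ → Plane) × ((ℕ → ℝ × Bool) × ℝ≥0∞) → ℝ≥0∞) (X ω, W ω) ∂μ =
      μ {ω | ENNReal.ofReal β < N.sinr P ω} := by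
    have hset : {ω | ENNReal.ofReal β < N.sinr P ω} = (fun ω => (X ω, W ω)) ⁻¹' A := by
      ext ω
      simp only [hA, mem_preimage, mem_ofPred_eq, Elements.sinr, interferenceB_eq]
      rfl
    rw [hset, ← lintegral_indicator_one ((hX'.prodMk hW') hAm)]
    rfl
  have e4 : ∀ᵐ ω ∂μ, ∫⁻ ω', A.indicator (1 : (ℕ → Plane) × ((ℕ → ℝ × Bool) × ℝ≥0∞) → ℝ≥0∞) (X ω, W ω') ∂μ =
      ∫⁻ ω', f (X ω, W ω') ∂μ := by
    filter_upwards [hN.bs_ppp.ae_nearestDist_pos P.lamB_pos] with ω hω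
    have h := hN.measure_lt_sinrOf hβ (X ω) hω
    refine Eq.trans ?_ h
    change _ = μ ((fun ω' => (X ω, W ω')) ⁻¹' A)
    rw [← lintegral_indicator_one ((measurable_const.prodMk hW') hAm)]
    rfl
  rw [← e3, e1, lintegral_congr_ae e4, ← e2]
  refine lintegral_congr fun ω => ?_
  rw [interferenceB_eq]
  rfl

/-- The integrand of the coverage probability, with both Laplace transforms made explicit. -/
noncomputable def coverageIntegrand (P : Params M) (β r : ℝ) : ℝ :=
  Real.exp (-(β * r ^ P.α / P.PB * P.noise)) *
    Real.exp (-(P.lamDTilde * (2 * Real.pi ^ 2 / P.α / Real.sin (2 * Real.pi / P.α)) *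
      (β * r ^ P.α / P.PB * P.PD) ^ (2 / P.α))) *
    Real.exp (-(2 * Real.pi * P.rhoS * P.lamB * r ^ 2 * H1 β P.α)) *
    nearestDensity P.lamB r

/-- The D2D interference is averaged first, independently of the BS sources. This leaves a function
of the serving distance times the BS factor, which is disintegrated along that distance. -/
lemma coverage_eq_lintegral (hN : IsSharedNetwork P μ N) {β : ℝ} (hβ : 0 < β) :
    μ {ω | ENNReal.ofReal β < N.sinr P ω} =
      ∫⁻ r in Ioi (0 : ℝ), ENNReal.ofReal (coverageIntegrand P β r) := by
  have hPB := P.PB_pos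
  set s : ℝ → ℝ := fun r => β * r ^ P.α / P.PB with hs
  have hs0 : ∀ r, 0 < r → 0 < s r := fun r hr => by simp only [hs]; positivity
  have hsm : Measurable s := by simp only [hs]; fun_prop
  set H : ℝ → ℝ≥0∞ := fun r => ENNReal.ofReal (Real.exp (-(s r * P.noise))) *
    ENNReal.ofReal (Real.exp (-(P.lamDTilde *
      (2 * Real.pi ^ 2 / P.α / Real.sin (2 * Real.pi / P.α)) * (s r * P.PD) ^ (2 / P.α)))) with hH
  have hHm : Measurable H := by simp only [hH]; fun_prop
  have hR := hN.servingDist_measurable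
  have hB := hN.interferenceB_measurable
  have hBS : Measurable[N.sigmaOf bsSources] fun ω => (N.servingDist ω, N.interferenceB P ω) :=
    (measurable_servingDist (.inl rfl)).prodMk (measurable_interferenceB subset_rfl)
  have hDS : Measurable[N.sigmaOf d2dSources] (N.interferenceD P) :=
    measurable_interferenceD subset_rfl
  have hfm : Measurable fun q : (ℝ × ℝ≥0∞) × ℝ≥0∞ =>
      nexp (ENNReal.ofReal (s q.1.1) * (q.2 + q.1.2 + ENNReal.ofReal P.noise)) := by
    refine measurable_nexp.comp ?_
    fun_prop
  have e1 := lintegral_eq_lintegral_lintegral_of_indep (hN.sigmaOf_le _) (hN.sigmaOf_le _)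
    (hN.indep_sigmaOf disjoint_bsSources_d2dSources) hBS hDS hfm
  set f : ℝ × ℝ≥0∞ → ℝ≥0∞ := fun q => H q.1 * nexp (ENNReal.ofReal (s q.1) * q.2) with hf
  have hfm' : Measurable f := by
    have := measurable_nexp
    simp only [hf]
    fun_prop
  have e2 : ∀ᵐ ω ∂μ, ∫⁻ ω', nexp (ENNReal.ofReal (s (N.servingDist ω)) *
      (N.interferenceD P ω' + N.interferenceB P ω + ENNReal.ofReal P.noise)) ∂μ =
      f (N.servingDist ω, N.interferenceB P ω) := by
    filter_upwards [hN.bs_ppp.ae_nearestDist_pos P.lamB_pos] with ω hω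
    have hR0 : 0 < s (N.servingDist ω) := hs0 _ hω
    simp_rw [mul_add, nexp_add, mul_assoc]
    have hm : Measurable fun ω' => nexp (ENNReal.ofReal (s (N.servingDist ω)) *
        N.interferenceD P ω') := measurable_nexp.comp (hN.interferenceD_measurable.const_mul _)
    rw [lintegral_mul_const _ hm,
      hN.lintegral_nexp_interferenceD hR0, ← ENNReal.ofReal_mul hR0.le,
      nexp_ofReal (mul_nonneg hR0.le P.noise_nonneg)]
    simp only [hf, hH]
    ring
  rw [hN.measure_lt_sinr hβ]
  refine e1.trans ?_
  rw [lintegral_congr_ae e2, ← lintegral_map hfm' (hR.prodMk hB),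
    ← compProd_map_condDistrib hB.aemeasurable, Measure.lintegral_compProd hfm',
    hN.lintegral_map_servingDist hfm'.lintegral_kernel_prod_right'.aemeasurable]
  refine lintegral_congr_ae ?_
  filter_upwards [hN.ae_lintegral_nexp_condDistrib_eq hβ, ae_restrict_mem measurableSet_Ioi]
    with r hr hr0
  simp only [hf]
  have hm : Measurable fun y => nexp (ENNReal.ofReal (s r) * y) :=
    measurable_nexp.comp (measurable_id.const_mul _)
  rw [lintegral_const_mul _ hm, hr, hH, coverageIntegrand, ENNReal.ofReal_mul (by positivity),
    ENNReal.ofReal_mul (by positivity), ENNReal.ofReal_mul (by positivity)]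

lemma coverageIntegrand_nonneg (P : Params M) (β : ℝ) {r : ℝ} (hr : 0 < r) :
    0 ≤ coverageIntegrand P β r := by
  have := (nearestDensity_pos P.lamB_pos hr).le
  unfold coverageIntegrand
  positivity

lemma aestronglyMeasurable_coverageIntegrand (P : Params M) (β : ℝ) :
    AEStronglyMeasurable (coverageIntegrand P β) (volume.restrict (Ioi 0)) := by
  have := measurable_nearestDensity P.lamB
  refine Measurable.aestronglyMeasurable ?_
  unfold coverageIntegrand
  fun_prop

/-- The integral of this nonnegative function is a probability, hence finite. -/
lemma integrableOn_coverageIntegrand (hN : IsSharedNetwork P μ N) {β : ℝ} (hβ : 0 < β) :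
    IntegrableOn (coverageIntegrand P β) (Ioi 0) := by
  refine ⟨aestronglyMeasurable_coverageIntegrand P β, ?_⟩
  rw [hasFiniteIntegral_iff_ofReal, ← hN.coverage_eq_lintegral hβ]
  · exact measure_lt_top _ _
  · filter_upwards [ae_restrict_mem measurableSet_Ioi] with r hr
    exact coverageIntegrand_nonneg P β hr

lemma coverage_eq_integral (hN : IsSharedNetwork P μ N) {β : ℝ} (hβ : 0 < β) :
    μ.real {ω | ENNReal.ofReal β < N.sinr P ω} =
      ∫ r in Ioi (0 : ℝ), coverageIntegrand P β r := by
  rw [integral_eq_lintegral_of_nonneg_ae _ (aestronglyMeasurable_coverageIntegrand P β),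
    ← hN.coverage_eq_lintegral hβ, measureReal_def]
  filter_upwards [ae_restrict_mem measurableSet_Ioi] with r hr
  exact coverageIntegrand_nonneg P β hr

lemma ae_laplaceB_eq (hN : IsSharedNetwork P μ N) {β : ℝ} (hβ : 0 < β) :
    ∀ᵐ r ∂(volume.restrict (Ioi (0 : ℝ))), laplaceB P μ N r (β * r ^ P.α / P.PB) =
      Real.exp (-(2 * Real.pi * P.rhoS * P.lamB * r ^ 2 * H1 β P.α)) := by
  filter_upwards [hN.ae_lintegral_nexp_condDistrib_eq hβ, ae_restrict_mem measurableSet_Ioi]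
    with r hr hr0
  have hr0 : 0 < r := hr0
  have hPB := P.PB_pos
  rw [laplaceB, laplace_of_pos _ (by positivity), hr, ENNReal.toReal_ofReal (Real.exp_pos _).le]

lemma ae_integrand_eq (hN : IsSharedNetwork P μ N) {β : ℝ} (hβ : 0 < β) :
    (fun r : ℝ => Real.exp (-(β * r ^ P.α / P.PB * P.noise)) *
      laplaceD P μ N (β * r ^ P.α / P.PB) * laplaceB P μ N r (β * r ^ P.α / P.PB) *
        nearestDensity P.lamB r) =ᵐ[volume.restrict (Ioi (0 : ℝ))] coverageIntegrand P β := by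
  filter_upwards [hN.ae_laplaceB_eq hβ, ae_restrict_mem measurableSet_Ioi] with r hr hr0
  have hr0 : 0 < r := hr0
  have hPB := P.PB_pos
  rw [hr, hN.laplaceD_eq (by positivity), coverageIntegrand]

end IsSharedNetwork

end D2D

theorem mainTheorem2 {M : ℕ} (P : D2D.Params M) {Ω : Type*} [MeasurableSpace Ω]
    (μ : Measure Ω) [IsProbabilityMeasure μ] (N : D2D.Elements M Ω)
    (hN : D2D.IsSharedNetwork P μ N) (β : ℝ) (hβ : 0 < β) :
    -- the distance to the serving BS has the stated density
    μ.map N.servingDist =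
      (volume.restrict (Ioi (0 : ℝ))).withDensity
        (fun r => ENNReal.ofReal (D2D.nearestDensity P.lamB r)) ∧
    -- the coverage probability
    IntegrableOn (fun r : ℝ =>
        Real.exp (-(β * r ^ P.α / P.PB * P.noise)) *
          D2D.laplaceD P μ N (β * r ^ P.α / P.PB) *
          D2D.laplaceB P μ N r (β * r ^ P.α / P.PB) *
          D2D.nearestDensity P.lamB r) (Ioi 0) ∧
    μ.real {ω | ENNReal.ofReal β < N.sinr P ω} =
      ∫ r in Ioi (0 : ℝ),
        Real.exp (-(β * r ^ P.α / P.PB * P.noise)) *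
          D2D.laplaceD P μ N (β * r ^ P.α / P.PB) *
          D2D.laplaceB P μ N r (β * r ^ P.α / P.PB) *
          D2D.nearestDensity P.lamB r ∧
    -- the Laplace transform of the D2D interference
    (∀ s : ℝ, 0 ≤ s →
      D2D.laplaceD P μ N s =
        Real.exp (-(P.lamDTilde * (2 * Real.pi ^ 2 / P.α / Real.sin (2 * Real.pi / P.α)) *
          (s * P.PD) ^ (2 / P.α)))) ∧
    -- the Laplace transform of the BS interference, given the distance to the serving BS
    (∀ᵐ r ∂(volume.restrict (Ioi (0 : ℝ))),
      D2D.laplaceB P μ N r (β * r ^ P.α / P.PB) =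
        Real.exp (-(2 * Real.pi * P.rhoS * P.lamB * r ^ 2 * D2D.H1 β P.α))) := by
  have h := hN.ae_integrand_eq hβ
  refine ⟨hN.map_servingDist, ?_, ?_, fun s hs => hN.laplaceD_eq hs, hN.ae_laplaceB_eq hβ⟩
  · exact (hN.integrableOn_coverageIntegrand hβ).congr h.symm
  · rw [integral_congr_ae h]
    exact hN.coverage_eq_integral hβ
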